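/- Let $d\ge 1$, $\lambda>0$, $\mu>-1$ and $n\in\{0,1,2,\dots\}$. Let $\mathbb B^d=\{x\in\mathbb R^d:\|x\|\le 1\}$, $W_\mu(x)=(1-\|x\|^2)^\mu$ and $b_\mu=\left(\int_{\mathbb B^d}W_\mu(x)\,dx\right)^{-1}$. For real polynomials $f,g$ in $d$ variables put $$\langle f,g\rangle_{\nabla,W_\mu,\mathbb B^d}=b_\mu\left[\int_{\mathbb B^d}f(x)g(x)W_\mu(x)\,dx+\lambda\int_{\mathbb B^d}\nabla f(x)\cdot\nabla g(x)\,W_\mu(x)\,dx\right],$$ and let $\mathcal V_n^d(\nabla,W_\mu,\mathbb B^d)$ be the space of polynomials of total degree at most $n$ that are orthogonal, with respect to this inner product, to all polynomials of total degree less than $n$. Let $w_{\alpha,\beta}(t)=(1-t)^\alpha(1+t)^\beta$, $B(\beta,d)=2\beta-(d-2)$ and $A(\beta,d)=\beta B(\beta,d)$. For real polynomials $f,g$ in one variable put $$(f,g)_{\alpha,\beta}=\int_{-1}^1 fg\,w_{\alpha,\beta}\,dt+2\lambda\int_{-1}^1\begin{pmatrix}f&f'\end{pmatrix}\begin{pmatrix}A(\beta,d)&B(\beta,d)(1+t)\\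 B(\beta,d)(1+t)&4(1+t)^2\end{pmatrix}\begin{pmatrix}g\\g'\end{pmatrix}w_{\alpha,\beta-1}(t)\,dt .$$ For $0\le j\le n/2$ let $\beta_j=n-2j+\frac{d-2}{2}$. (If $2j=n$, then $A(\beta_j,d)=B(\beta_j,d)=0$ and the second integrand is $4f'g'w_{\alpha,\beta_j+1}$.) For each $0\le j\le n/2$ there is exactly one polynomial $q_j^{(\mu,\beta_j)}$ of degree $j$ with leading coefficient $2^{-j}\binom{2j+\mu+\beta_j}{j}$ that is orthogonal, with respect to $(\cdot,\cdot)_{\mu,\beta_j}$, to all polynomials of degree less than $j$. Let $\mathcal H_m^d$ be the space of homogeneous harmonic polynomials of degree $m$ in $d$ variables and $a_m^d=\dim\mathcal H_m^d$. For each $0\le j\le n/2$ let $\{Y_\nu^{n-2j}:1\le\nu\le a_{n-2j}^d\}$ be a basis of $\mathcal H_{n-2j}^d$ that is orthonormal with respect to $\frac1{\omega_d}\int_{\mathbb S^{d-1}}fg\,d\sigma$, where $\sigma$ is the surface measure of the unit sphere and $\omega_d=\sigma(\mathbb S^{d-1})$. Define $$R_{j,\nu}^n(x)=q_j^{(\mu,\beta_j)}(2\|x\|^2-1)\,Y_\nu^{n-2j}(x).$$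 Then $\{R_{j,\nu}^n:0\le j\le n/2,\ 1\le\nu\le a_{n-2j}^d\}$ is a mutually orthogonal basis of $\mathcal V_n^d(\nabla,W_\mu,\mathbb B^d)$, and for all such $j,\nu$ $$\langle R_{j,\nu}^n,R_{j,\nu}^n\rangle_{\nabla,W_\mu,\mathbb B^d}=\frac{\Gamma(\mu+1+\frac d2)}{\Gamma(\mu+1)\,\Gamma(\frac d2)\,2^{\beta_j+\mu+1}}\left(q_j^{(\mu,\beta_j)},q_j^{(\mu,\beta_j)}\right)_{\mu,\beta_j}.$$ -/

import Mathlib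

open MeasureTheory

noncomputable section

namespace BallSobolev

/-! Polynomials in `d` variables are `MvPolynomial (Fin d) ℝ`; they are evaluated at points of
Euclidean space `ℝ^d`. -/

/-- The value of the polynomial `f` at the point `x` of Euclidean space. -/
def evalAt {d : ℕ} (f : MvPolynomial (Fin d) ℝ) (x : EuclideanSpace ℝ (Fin d)) : ℝ :=
  MvPolynomial.eval (fun i => x i) f

/-- `∇f(x) · ∇g(x)`. -/
def gradDot {d : ℕ} (f g : MvPolynomial (Fin d) ℝ) (x : EuclideanSpace ℝ (Fin d)) : ℝ :=
  ∑ i, evalAt (MvPolynomial.pderiv i f) x * evalAt (MvPolynomial.pderiv i g) x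

/-- The weight `W_μ(x) = (1 - ‖x‖²)^μ` on the unit ball. -/
def ballWeight (d : ℕ) (μ : ℝ) (x : EuclideanSpace ℝ (Fin d)) : ℝ :=
  (1 - ‖x‖ ^ 2) ^ μ

/-- The normalizing constant `b_μ = (∫_{𝔹^d} W_μ(x) dx)⁻¹`. -/
def ballConst (d : ℕ) (μ : ℝ) : ℝ :=
  (∫ x in Metric.closedBall (0 : EuclideanSpace ℝ (Fin d)) 1, ballWeight d μ x)⁻¹

/-- The Sobolev inner product
`b_μ [ ∫_{𝔹^d} f g W_μ dx + lam ∫_{𝔹^d} ∇f · ∇g W_μ dx ]` on polynomials in `d` variables. -/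
def ballInner (d : ℕ) (μ lam : ℝ) (f g : MvPolynomial (Fin d) ℝ) : ℝ :=
  ballConst d μ *
    ((∫ x in Metric.closedBall (0 : EuclideanSpace ℝ (Fin d)) 1,
        evalAt f x * evalAt g x * ballWeight d μ x) +
      lam * ∫ x in Metric.closedBall (0 : EuclideanSpace ℝ (Fin d)) 1,
        gradDot f g x * ballWeight d μ x)

/-- The orthogonal polynomials of degree `n` for `ballInner`: polynomials of total degree at most
`n` that are orthogonal to all polynomials of total degree less than `n`. -/
def orthSpace (d : ℕ) (μ lam : ℝ) (n : ℕ) : Set (MvPolynomial (Fin d) ℝ) :=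
  {P | P.totalDegree ≤ n ∧
    ∀ Q : MvPolynomial (Fin d) ℝ, Q.totalDegree < n → ballInner d μ lam P Q = 0}

/-- The Laplace operator on polynomials. -/
def laplacian (d : ℕ) : MvPolynomial (Fin d) ℝ →ₗ[ℝ] MvPolynomial (Fin d) ℝ :=
  ∑ i, (MvPolynomial.pderiv i).toLinearMap ∘ₗ (MvPolynomial.pderiv i).toLinearMap

/-- The space `H_m^d` of homogeneous harmonic polynomials of degree `m` in `d` variables. -/
def harmonicSpace (d m : ℕ) : Submodule ℝ (MvPolynomial (Fin d) ℝ) :=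
  MvPolynomial.homogeneousSubmodule (Fin d) ℝ m ⊓ LinearMap.ker (laplacian d)

/-- `a_m^d = dim H_m^d`. -/
def harmonicDim (d m : ℕ) : ℕ := Module.finrank ℝ (harmonicSpace d m)

/-- The surface measure of the unit sphere of `ℝ^d`. -/
def surfaceMeasure (d : ℕ) : Measure (Metric.sphere (0 : EuclideanSpace ℝ (Fin d)) 1) :=
  (volume : Measure (EuclideanSpace ℝ (Fin d))).toSphere

/-- The normalized inner product `(1/ω_d) ∫_{S^{d-1}} f g dσ`, where `ω_d` is the surface area. -/
def sphereInner (d : ℕ) (f g : MvPolynomial (Fin d) ℝ) : ℝ :=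
  ((surfaceMeasure d).real Set.univ)⁻¹ *
    ∫ ξ : Metric.sphere (0 : EuclideanSpace ℝ (Fin d)) 1,
      evalAt f ξ * evalAt g ξ ∂(surfaceMeasure d)

/-- A basis of `H_m^d` is orthonormal if it is so for the inner product on the sphere. -/
def IsOrthonormalHarmonic {d m : ℕ}
    (Y : Module.Basis (Fin (harmonicDim d m)) ℝ (harmonicSpace d m)) : Prop :=
  ∀ ν η, sphereInner d (Y ν : MvPolynomial (Fin d) ℝ) (Y η : MvPolynomial (Fin d) ℝ) =
    if ν = η then 1 else 0

/-- The Jacobi weight `w_{α,β}(t) = (1 - t)^α (1 + t)^β`. -/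
def jacobiWeight (α β t : ℝ) : ℝ := (1 - t) ^ α * (1 + t) ^ β

/-- `B(β, d) = 2 β - (d - 2)`. -/
def coefB (d : ℕ) (β : ℝ) : ℝ := 2 * β - ((d : ℝ) - 2)

/-- `A(β, d) = β B(β, d)`. -/
def coefA (d : ℕ) (β : ℝ) : ℝ := β * coefB d β

/-- The `2 × 2` matrix in the univariate Sobolev inner product. -/
def sobolevMatrix (d : ℕ) (β t : ℝ) : Matrix (Fin 2) (Fin 2) ℝ :=
  !![coefA d β, coefB d β * (1 + t);
     coefB d β * (1 + t), 4 * (1 + t) ^ 2]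

/-- The univariate Sobolev inner product
`(f, g)_{α,β} = ∫ f g w_{α,β} dt + 2 lam ∫ (f, f') M(t) (g, g')ᵀ w_{α,β-1} dt` over `[-1, 1]`. -/
def uniInner (d : ℕ) (lam α β : ℝ) (f g : Polynomial ℝ) : ℝ :=
  (∫ t in (-1 : ℝ)..1, f.eval t * g.eval t * jacobiWeight α β t) +
    2 * lam * ∫ t in (-1 : ℝ)..1,
      (![f.eval t, f.derivative.eval t] ⬝ᵥ
        Matrix.mulVec (sobolevMatrix d β t) ![g.eval t, g.derivative.eval t]) *
        jacobiWeight α (β - 1) t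

/-- The leading coefficient `k_j^{(α,β)} = 2^{-j} binom(2j + α + β, j)` of the Jacobi polynomial
`P_j^{(α,β)}`, with the generalized binomial coefficient. -/
def jacobiLead (j : ℕ) (α β : ℝ) : ℝ := 1 / 2 ^ j * Ring.choose (2 * (j : ℝ) + α + β) j

/-- `q` is the `j`-th orthogonal polynomial `q_j^{(α,β)}` of `uniInner`: it has degree `j`, the
leading coefficient of the Jacobi polynomial `P_j^{(α,β)}`, and is orthogonal to all polynomials of
lower degree. -/
structure IsSobolevOP (d : ℕ) (lam α β : ℝ) (j : ℕ) (q : Polynomial ℝ) : Prop where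
  natDegree_eq : q.natDegree = j
  leadingCoeff_eq : q.leadingCoeff = jacobiLead j α β
  orthogonal : ∀ g : Polynomial ℝ, g.degree < (j : WithBot ℕ) → uniInner d lam α β q g = 0

/-- `β_j = n - 2 j + (d - 2) / 2`. -/
def betaIdx (d n j : ℕ) : ℝ := (n : ℝ) - 2 * (j : ℝ) + ((d : ℝ) - 2) / 2

/-- The polynomial `q(2 ‖x‖² - 1) Y(x)`, where `‖x‖² = x_1² + ⋯ + x_d²`. -/
def ballPoly {d : ℕ} (q : Polynomial ℝ) (Y : MvPolynomial (Fin d) ℝ) :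
    MvPolynomial (Fin d) ℝ :=
  Polynomial.aeval (2 * (∑ i, MvPolynomial.X i ^ 2) - 1 : MvPolynomial (Fin d) ℝ) q * Y

theorem evalAt_ballPoly {d : ℕ} (q : Polynomial ℝ) (Y : MvPolynomial (Fin d) ℝ)
    (x : EuclideanSpace ℝ (Fin d)) :
    evalAt (ballPoly q Y) x = q.eval (2 * ‖x‖ ^ 2 - 1) * evalAt Y x := by
  have h : MvPolynomial.eval (fun i => x i)
      (Polynomial.aeval (2 * (∑ i, MvPolynomial.X i ^ 2) - 1 : MvPolynomial (Fin d) ℝ) q) =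
      q.eval (2 * ‖x‖ ^ 2 - 1) := by
    rw [← MvPolynomial.coe_aeval_eq_eval, RingHom.coe_coe, ← Polynomial.aeval_algHom_apply,
      EuclideanSpace.real_norm_sq_eq]
    simp [Polynomial.aeval_def, Polynomial.eval₂_eq_eval_map]
  simp [evalAt, ballPoly, h]

end BallSobolev

end

open BallSobolev

/-! Take f = p(2‖x‖²-1) Y and g = q(2‖x‖²-1) Z with Y, Z homogeneous harmonic. Then f g is a radial
factor times Y Z, and by Euler's identity ∇f·∇g is a radial factor times Y Z plus p q ∇Y·∇Z
(`gradPoly_ballPoly`). In polar coordinates everything reduces to the sphere integrals of Y Z and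
∇Y·∇Z and to radial integrals, which t = 2r²-1 turns into Jacobi integrals.

The sphere integrals come from Gaussian ones: integration by parts against exp(-‖x‖²) gives ∫ ∇P·∇Q
= 2l ∫ P Q for harmonic Q of degree l. Symmetry in P and Q kills both integrals when the degrees
differ; when both degrees are m, the ratio of the Gamma factors for degrees 2m-2 and 2m gives ∫
∇Y·∇Z = m(2m+d-2) ∫ Y Z on the sphere. With β = m+(d-2)/2 this constant is A(β, d) and 2m is B(β,
d), so the ball product equals the univariate product times that of Y and Z on the sphere, up to the
stated constant (`ballInner_ballPoly`, `ballInner_ballPoly_of_ne`). Mutual orthogonality and the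
norms follow at once.

Spanning needs no dimension count. The Fischer decomposition writes every polynomial of degree below
n through the products p(2‖x‖²-1) Z with 2 deg p + deg Z < n, so the R_{j,ν} are orthogonal to all
of these. A polynomial of degree at most n lies in the span of the R_{j,ν} plus that lower space
(`lowSpace_succ_le`); if it is also orthogonal to the lower space, its lower part is orthogonal to
itself and vanishes by positive definiteness. -/

/-! ### Fischer decomposition into powers of ‖x‖² times harmonics. -/

noncomputable section
namespace BallSobolev
open MvPolynomial

variable {d : ℕ}

/-- The polynomial `‖x‖² = x_1² + ⋯ + x_d²`. -/
def normSq (d : ℕ) : MvPolynomial (Fin d) ℝ := ∑ i, X i ^ 2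

lemma laplacian_apply (P : MvPolynomial (Fin d) ℝ) :
    laplacian d P = ∑ i, pderiv i (pderiv i P) := by
  simp [laplacian]

/-- The polynomial `∇P · ∇Q`. -/
def gradPoly (P Q : MvPolynomial (Fin d) ℝ) : MvPolynomial (Fin d) ℝ :=
  ∑ i, pderiv i P * pderiv i Q

lemma laplacian_mul (P Q : MvPolynomial (Fin d) ℝ) :
    laplacian d (P * Q) = laplacian d P * Q + 2 * gradPoly P Q + P * laplacian d Q := by
  simp only [laplacian_apply, gradPoly, Finset.sum_mul, Finset.mul_sum, ← Finset.sum_add_distrib]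
  refine Finset.sum_congr rfl fun i _ => ?_
  simp only [pderiv_mul, map_add]
  ring

lemma pderiv_normSq (i : Fin d) : pderiv i (normSq d) = 2 * X i := by
  simp only [normSq, map_sum, pderiv_pow, pderiv_X]
  rw [Finset.sum_eq_single i]
  · simp
  · intro j _ hj
    simp [hj.symm]
  · simp

lemma laplacian_normSq : laplacian d (normSq d) = 2 * (d : MvPolynomial (Fin d) ℝ) := by
  have h : ∀ i : Fin d, pderiv i (2 * X i : MvPolynomial (Fin d) ℝ) = 2 := fun i => by
    have h2 : (2 : MvPolynomial (Fin d) ℝ) = C 2 := (map_ofNat C 2).symm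
    rw [h2, pderiv_C_mul]; simp
  simp only [laplacian_apply, pderiv_normSq, h]
  simp [mul_comm]

lemma isHomogeneous_normSq : (normSq d).IsHomogeneous 2 :=
  IsHomogeneous.sum _ _ _ fun i _ => by simpa using (isHomogeneous_X ℝ i).pow 2

lemma normSq_ne_zero (hd : 1 ≤ d) : normSq d ≠ 0 := by
  intro h
  have := congrArg (eval fun _ => (1 : ℝ)) h
  simp [normSq] at this
  omega

lemma gradPoly_normSq {k : ℕ} {P : MvPolynomial (Fin d) ℝ} (hP : P.IsHomogeneous k) :
    gradPoly (normSq d) P = 2 * (k : MvPolynomial (Fin d) ℝ) * P := by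
  simp only [gradPoly, pderiv_normSq, mul_assoc, ← Finset.mul_sum]
  rw [hP.sum_X_mul_pderiv, nsmul_eq_mul]

lemma laplacian_normSq_mul {k : ℕ} {P : MvPolynomial (Fin d) ℝ} (hP : P.IsHomogeneous k) :
    laplacian d (normSq d * P) = C (2 * d + 4 * k : ℝ) * P + normSq d * laplacian d P := by
  rw [laplacian_mul, laplacian_normSq, gradPoly_normSq hP]
  simp only [map_add, map_mul, map_natCast, map_ofNat]
  ring

lemma isHomogeneous_normSq_pow_mul {k : ℕ} {P : MvPolynomial (Fin d) ℝ} (hP : P.IsHomogeneous k)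
    (s : ℕ) : (normSq d ^ s * P).IsHomogeneous (2 * s + k) :=
  (isHomogeneous_normSq.pow s).mul hP

lemma exists_laplacian_normSq_pow_mul (hd : 1 ≤ d) (k s : ℕ) :
    ∃ c : ℝ, 0 < c ∧ ∀ P : MvPolynomial (Fin d) ℝ, P.IsHomogeneous k →
      laplacian d (normSq d ^ (s + 1) * P) =
        C c * (normSq d ^ s * P) + normSq d ^ (s + 1) * laplacian d P := by
  have hd' : (0 : ℝ) < d := by exact_mod_cast hd
  induction s with
  | zero =>
    refine ⟨2 * d + 4 * k, by positivity, fun P hP => ?_⟩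
    simpa using laplacian_normSq_mul hP
  | succ s ih =>
    obtain ⟨c, hc, h⟩ := ih
    -- Apply `laplacian_normSq_mul` to ‖x‖^(2(s+1)) P, of degree 2(s+1)+k; its own Laplacian
    -- contributes c.
    refine ⟨2 * d + 4 * (2 * (s + 1) + k : ℕ) + c, by positivity, fun P hP => ?_⟩
    rw [pow_succ' _ (s + 1), mul_assoc,
      laplacian_normSq_mul (isHomogeneous_normSq_pow_mul hP (s + 1)), h P hP]
    simp only [C_add]
    ring

lemma isHomogeneous_laplacian {k : ℕ} {P : MvPolynomial (Fin d) ℝ} (hP : P.IsHomogeneous k) :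
    (laplacian d P).IsHomogeneous (k - 2) := by
  rw [laplacian_apply]
  exact IsHomogeneous.sum _ _ _ fun i _ => by simpa [Nat.sub_sub] using hP.pderiv.pderiv

lemma laplacian_eq_zero_of_lt_two {k : ℕ} (hk : k < 2) {P : MvPolynomial (Fin d) ℝ}
    (hP : P.IsHomogeneous k) : laplacian d P = 0 := by
  rw [laplacian_apply]
  refine Finset.sum_eq_zero fun i _ => ?_
  have h : (pderiv i P).IsHomogeneous 0 := by
    have := hP.pderiv (i := i)
    rwa [show k - 1 = 0 by omega] at this
  rw [← totalDegree_zero_iff_isHomogeneous, totalDegree_eq_zero_iff_eq_C] at h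
  rw [h, pderiv_C]

/-- Descent on the degree. Cancelling ‖x‖^(2s) from the expanded Laplacian shows P = ‖x‖² P' with P'
a multiple of ΔP, of degree k-2. Then ‖x‖^(2(s+2)) P' is the same harmonic polynomial, so P'
satisfies the hypothesis with s+1. This is why the statement is made for all s. -/
lemma eq_zero_of_laplacian_normSq_pow_mul (hd : 1 ≤ d) (k : ℕ) :
    ∀ (s : ℕ) (P : MvPolynomial (Fin d) ℝ), P.IsHomogeneous k →
      laplacian d (normSq d ^ (s + 1) * P) = 0 → P = 0 := by
  induction k using Nat.strong_induction_on with
  | _ k ih =>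
    intro s P hP h
    obtain ⟨c, hc, hs⟩ := exists_laplacian_normSq_pow_mul hd k s
    rw [hs P hP, pow_succ, mul_left_comm, mul_assoc, ← mul_add] at h
    have h1 := (mul_eq_zero.1 h).resolve_left (pow_ne_zero _ (normSq_ne_zero hd))
    have hP' : P = normSq d * (C (-c⁻¹) * laplacian d P) := by
      have h2 : C c⁻¹ * (C c * P + normSq d * laplacian d P) = 0 := by rw [h1, mul_zero]
      rw [mul_add, ← mul_assoc, ← C_mul, inv_mul_cancel₀ hc.ne', C_1, one_mul] at h2
      rw [C_neg]
      linear_combination h2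
    rcases lt_or_ge k 2 with hk | hk
    · rw [hP', laplacian_eq_zero_of_lt_two hk hP]; simp
    · have h3 : (C (-c⁻¹) * laplacian d P).IsHomogeneous (k - 2) := by
        have := (isHomogeneous_C (Fin d) (-c⁻¹)).mul (isHomogeneous_laplacian hP)
        rwa [zero_add] at this
      have h4 : C (-c⁻¹) * laplacian d P = 0 := by
        refine ih (k - 2) (by omega) (s + 1) _ h3 ?_
        rw [pow_succ, mul_assoc, ← hP', hs P hP, pow_succ, mul_left_comm, mul_assoc, ← mul_add,
          h1, mul_zero]
      rw [hP', h4, mul_zero]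

instance finiteDimensional_homogeneousSubmodule (k : ℕ) :
    FiniteDimensional ℝ (homogeneousSubmodule (Fin d) ℝ k) :=
  Module.Finite.iff_fg.2 (homogeneousSubmodule_fg _ _ k)

/-- P ↦ Δ(‖x‖² P) is an injective endomorphism of a finite-dimensional space, hence onto. -/
lemma exists_laplacian_normSq_mul_eq (hd : 1 ≤ d) {k : ℕ} {Q : MvPolynomial (Fin d) ℝ}
    (hQ : Q.IsHomogeneous k) :
    ∃ P : MvPolynomial (Fin d) ℝ, P.IsHomogeneous k ∧ laplacian d (normSq d * P) = Q := by
  let T : homogeneousSubmodule (Fin d) ℝ k →ₗ[ℝ] homogeneousSubmodule (Fin d) ℝ k :=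
    ((laplacian d ∘ₗ LinearMap.mulLeft ℝ (normSq d)).restrict fun P hP => by
      have := isHomogeneous_laplacian (isHomogeneous_normSq_pow_mul hP 1)
      simpa [mem_homogeneousSubmodule] using this)
  have hT : Function.Injective T := by
    rw [← LinearMap.ker_eq_bot, LinearMap.ker_eq_bot']
    intro P hP
    have : laplacian d (normSq d ^ (0 + 1) * P) = 0 := by
      simpa [T] using congrArg Subtype.val hP
    exact Subtype.ext (eq_zero_of_laplacian_normSq_pow_mul hd k 0 _ P.2 this)
  obtain ⟨P, hP⟩ := LinearMap.injective_iff_surjective.1 hT ⟨Q, hQ⟩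
  exact ⟨P, P.2, by simpa [T] using congrArg Subtype.val hP⟩

/-- The Fischer decomposition of homogeneous polynomials. -/
lemma mem_span_normSq_pow_mul_harmonic (hd : 1 ≤ d) (n : ℕ) :
    ∀ P : MvPolynomial (Fin d) ℝ, P.IsHomogeneous n →
      P ∈ Submodule.span ℝ {F | ∃ i k : ℕ, 2 * i + k = n ∧ ∃ Y ∈ harmonicSpace d k,
        F = normSq d ^ i * Y} := by
  induction n using Nat.strong_induction_on with
  | _ n ih =>
    intro P hP
    rcases lt_or_ge n 2 with hn | hn
    · exact Submodule.subset_span ⟨0, n, by simp, P,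
        ⟨hP, laplacian_eq_zero_of_lt_two hn hP⟩, by simp⟩
    obtain ⟨Q, hQ, hΔ⟩ := exists_laplacian_normSq_mul_eq hd (isHomogeneous_laplacian hP)
    have hQ' : (normSq d * Q).IsHomogeneous n := by
      have := isHomogeneous_normSq_pow_mul hQ 1
      rwa [pow_one, show 2 * 1 + (n - 2) = n by omega] at this
    have h1 : P - normSq d * Q ∈ harmonicSpace d n :=
      ⟨Submodule.sub_mem _ hP hQ', by simp [hΔ]⟩
    have h2 : normSq d * Q ∈ Submodule.span ℝ {F | ∃ i k : ℕ, 2 * i + k = n ∧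
        ∃ Y ∈ harmonicSpace d k, F = normSq d ^ i * Y} := by
      have := Submodule.mem_map_of_mem (f := LinearMap.mulLeft ℝ (normSq d))
        (ih (n - 2) (by omega) Q hQ)
      rw [Submodule.map_span] at this
      refine Submodule.span_mono ?_ this
      rintro _ ⟨_, ⟨i, k, hik, Y, hY, rfl⟩, rfl⟩
      exact ⟨i + 1, k, by omega, Y, hY, by simp [pow_succ]; ring⟩
    rw [← sub_add_cancel P (normSq d * Q)]
    exact add_mem (Submodule.subset_span ⟨0, n, by simp, _, h1, by simp⟩) h2

end BallSobolev
end

/-! ### Polar coordinates, Gaussian integrals and harmonics on the sphere. -/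

noncomputable section
namespace BallSobolev
open MvPolynomial Set

variable {d : ℕ}

/-- Integration in polar coordinates of a function that separates in these coordinates. -/
lemma integral_eq_radial_mul_sphere (hd : 1 ≤ d) {F : EuclideanSpace ℝ (Fin d) → ℝ} {g : ℝ → ℝ}
    {h : Metric.sphere (0 : EuclideanSpace ℝ (Fin d)) 1 → ℝ}
    (hF : ∀ (ξ : Metric.sphere (0 : EuclideanSpace ℝ (Fin d)) 1) (r : ℝ), 0 < r →
      F (r • (ξ : EuclideanSpace ℝ (Fin d))) = g r * h ξ) :
    ∫ x, F x = (∫ r in Ioi (0 : ℝ), r ^ (d - 1) * g r) * ∫ ξ, h ξ ∂surfaceMeasure d := by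
  have hfr : Module.finrank ℝ (EuclideanSpace ℝ (Fin d)) = d := by simp
  have : Nontrivial (EuclideanSpace ℝ (Fin d)) :=
    Module.nontrivial_of_finrank_pos (R := ℝ) (by omega)
  let vol : Measure (EuclideanSpace ℝ (Fin d)) := volume
  calc ∫ x, F x = ∫ x : ({(0)}ᶜ : Set (EuclideanSpace ℝ (Fin d))), F x ∂(vol.comap (↑)) := by
        rw [integral_subtype_comap (measurableSet_singleton _).compl F, restrict_compl_singleton]
    _ = ∫ p, h p.1 * g p.2 ∂vol.toSphere.prod (.volumeIoiPow (d - 1)) := by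
        have := vol.measurePreserving_homeomorphUnitSphereProd.integral_comp
          (Homeomorph.measurableEmbedding _) (fun p => h p.1 * g p.2)
        rw [hfr] at this
        rw [← this]
        refine integral_congr_ae (.of_forall fun x => ?_)
        have hx : (x : EuclideanSpace ℝ (Fin d)) =
            ((homeomorphUnitSphereProd _ x).2 : ℝ) •
              ((homeomorphUnitSphereProd _ x).1 : EuclideanSpace ℝ (Fin d)) := by
          have hx0 : ‖(x : EuclideanSpace ℝ (Fin d))‖ ≠ 0 := norm_ne_zero_iff.2 x.2
          simp [smul_smul, hx0]
        change F x = _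
        conv_lhs => rw [hx]
        rw [hF _ _ (homeomorphUnitSphereProd _ x).2.2, mul_comm]
    _ = (∫ ξ, h ξ ∂vol.toSphere) * ∫ r : Ioi (0 : ℝ), g r ∂.volumeIoiPow (d - 1) :=
        integral_prod_mul h (fun r : Ioi (0 : ℝ) => g r)
    _ = _ := by
        rw [mul_comm]
        congr 1
        simp only [Measure.volumeIoiPow, ENNReal.ofReal]
        rw [integral_withDensity_eq_integral_smul,
          integral_subtype_comap measurableSet_Ioi fun a ↦ Real.toNNReal (a ^ (d - 1)) • g a,
          setIntegral_congr_fun measurableSet_Ioi fun x hx ↦ ?_]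
        · simp only [NNReal.smul_def, Real.coe_toNNReal _ (pow_nonneg (mem_Ioi.1 hx).le _),
            smul_eq_mul]
        · exact (measurable_subtype_coe.pow_const _).real_toNNReal

/-- The integral of a polynomial over the unit sphere. -/
def sphereInt (P : MvPolynomial (Fin d) ℝ) : ℝ :=
  ∫ ξ : Metric.sphere (0 : EuclideanSpace ℝ (Fin d)) 1, evalAt P ξ ∂surfaceMeasure d

lemma evalAt_smul {k : ℕ} {P : MvPolynomial (Fin d) ℝ} (hP : P.IsHomogeneous k) (r : ℝ)
    (x : EuclideanSpace ℝ (Fin d)) : evalAt P (r • x) = r ^ k * evalAt P x := by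
  simp only [evalAt, eval_eq', Finset.mul_sum]
  refine Finset.sum_congr rfl fun m hm => ?_
  have h : ∑ i, m i = k := by
    rw [← Finsupp.degree_eq_sum, ← hP (mem_support_iff.1 hm), Finsupp.degree_eq_weight_one]
    rfl
  simp only [PiLp.smul_apply, smul_eq_mul, mul_pow, Finset.prod_mul_distrib,
    Finset.prod_pow_eq_pow_sum, h]
  ring

lemma integral_evalAt_mul_radial (hd : 1 ≤ d) {k : ℕ} {P : MvPolynomial (Fin d) ℝ}
    (hP : P.IsHomogeneous k) (φ : ℝ → ℝ) :
    ∫ x, evalAt P x * φ ‖x‖ = (∫ r in Ioi (0 : ℝ), r ^ (d - 1) * (r ^ k * φ r)) * sphereInt P := by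
  refine integral_eq_radial_mul_sphere hd fun ξ r hr => ?_
  rw [evalAt_smul hP, norm_smul, norm_eq_of_mem_sphere, Real.norm_of_nonneg hr.le, mul_one]
  ring

lemma setIntegral_closedBall_evalAt_mul_radial (hd : 1 ≤ d) {k : ℕ} {P : MvPolynomial (Fin d) ℝ}
    (hP : P.IsHomogeneous k) (φ : ℝ → ℝ) :
    ∫ x in Metric.closedBall (0 : EuclideanSpace ℝ (Fin d)) 1, evalAt P x * φ ‖x‖ =
      (∫ r in Ioo (0 : ℝ) 1, r ^ (d - 1 + k) * φ r) * sphereInt P := by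
  -- The cutoff to the ball is itself radial, so it is absorbed into φ.
  have h := integral_evalAt_mul_radial hd hP ((Iic 1).indicator φ)
  rw [← integral_indicator Metric.isClosed_closedBall.measurableSet]
  convert h using 1
  · refine integral_congr_ae (.of_forall fun x => ?_)
    by_cases hx : ‖x‖ ≤ 1 <;> simp [Set.indicator, hx]
  · rw [← integral_Ioc_eq_integral_Ioo, ← Ioi_inter_Iic, ← setIntegral_indicator measurableSet_Iic]
    congr 2
    ext r
    by_cases hr : r ≤ 1 <;> simp [Set.indicator, hr, pow_add, mul_assoc]

lemma hasFDerivAt_evalAt (P : MvPolynomial (Fin d) ℝ) (x : EuclideanSpace ℝ (Fin d)) :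
    HasFDerivAt (evalAt P) (∑ i, evalAt (pderiv i P) x •
      (EuclideanSpace.proj i : EuclideanSpace ℝ (Fin d) →L[ℝ] ℝ)) x := by
  induction P using MvPolynomial.induction_on with
  | C a =>
    have h : evalAt (C a : MvPolynomial (Fin d) ℝ) = fun _ => a := by ext; simp [evalAt]
    rw [h]
    refine (hasFDerivAt_const a x).congr_fderiv ?_
    simp [evalAt]
  | add p q hp hq =>
    have h : evalAt (p + q) = evalAt p + evalAt q := by ext; simp [evalAt]
    rw [h]
    refine (hp.add hq).congr_fderiv ?_
    simp [evalAt, add_smul, Finset.sum_add_distrib]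
  | mul_X p j hp =>
    have h : evalAt (p * X j) = fun x => evalAt p x *
        (EuclideanSpace.proj j : EuclideanSpace ℝ (Fin d) →L[ℝ] ℝ) x := by ext; simp [evalAt]
    rw [h]
    refine (hp.mul (EuclideanSpace.proj j :
      EuclideanSpace ℝ (Fin d) →L[ℝ] ℝ).hasFDerivAt).congr_fderiv ?_
    have h2 : ∀ i, evalAt (pderiv i (p * X j)) x =
        evalAt p x * (if i = j then 1 else 0) + x j * evalAt (pderiv i p) x := fun i => by
      by_cases hij : i = j
      · subst hij; simp [evalAt]
      · simp [evalAt, hij, pderiv_X_of_ne (Ne.symm hij)]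
    simp only [h2, add_smul, Finset.sum_add_distrib, Finset.smul_sum, mul_smul]
    simp

lemma continuous_evalAt (P : MvPolynomial (Fin d) ℝ) : Continuous (evalAt P) :=
  continuous_iff_continuousAt.2 fun x => (hasFDerivAt_evalAt P x).continuousAt

lemma evalAt_add (P Q : MvPolynomial (Fin d) ℝ) (x : EuclideanSpace ℝ (Fin d)) :
    evalAt (P + Q) x = evalAt P x + evalAt Q x := by
  simp [evalAt]

lemma evalAt_mul (P Q : MvPolynomial (Fin d) ℝ) (x : EuclideanSpace ℝ (Fin d)) :
    evalAt (P * Q) x = evalAt P x * evalAt Q x := by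
  simp [evalAt]

/-- An exponential bound passes through the induction on P with no bookkeeping of degrees, and a
Gaussian still dominates it. -/
lemma exists_abs_evalAt_le (P : MvPolynomial (Fin d) ℝ) :
    ∃ C a : ℝ, 0 ≤ C ∧ 0 ≤ a ∧ ∀ x, |evalAt P x| ≤ C * Real.exp (a * ‖x‖) := by
  induction P using MvPolynomial.induction_on with
  | C c => exact ⟨|c|, 0, abs_nonneg _, le_rfl, fun x => by simp [evalAt]⟩
  | add p q hp hq =>
    obtain ⟨C₁, a₁, hC₁, ha₁, h₁⟩ := hp
    obtain ⟨C₂, a₂, hC₂, ha₂, h₂⟩ := hq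
    refine ⟨C₁ + C₂, a₁ + a₂, by positivity, by positivity, fun x => ?_⟩
    rw [evalAt_add, add_mul]
    refine (abs_add_le _ _).trans (add_le_add ((h₁ x).trans ?_) ((h₂ x).trans ?_)) <;> gcongr <;>
      linarith
  | mul_X p j hp =>
    obtain ⟨C₁, a₁, hC₁, ha₁, h₁⟩ := hp
    refine ⟨C₁, a₁ + 1, hC₁, by positivity, fun x => ?_⟩
    have h2 : |x j| ≤ Real.exp ‖x‖ := by
      refine (PiLp.norm_apply_le x j).trans ?_
      linarith [Real.add_one_le_exp ‖x‖]
    rw [evalAt_mul, abs_mul, add_mul, Real.exp_add, one_mul, ← mul_assoc]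
    refine mul_le_mul (h₁ x) (by simpa [evalAt] using h2) (abs_nonneg _) (by positivity)

lemma integrable_evalAt_mul_gaussian (P : MvPolynomial (Fin d) ℝ) :
    Integrable fun x => evalAt P x * Real.exp (-‖x‖ ^ 2) := by
  obtain ⟨C, a, hC, -, h⟩ := exists_abs_evalAt_le P
  have hG : Integrable fun x : EuclideanSpace ℝ (Fin d) => Real.exp (-‖x‖ ^ 2 / 2) := by
    have := (GaussianFourier.integrable_cexp_neg_mul_sq_norm_add (b := 1 / 2) (by norm_num) 0
      (0 : EuclideanSpace ℝ (Fin d))).norm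
    refine this.congr (.of_forall fun x => ?_)
    simp only [Complex.norm_exp]
    congr 1
    simp [← Complex.ofReal_pow]
    ring
  refine (hG.const_mul (C * Real.exp (a ^ 2 / 2))).mono' ?_ (.of_forall fun x => ?_)
  · exact ((continuous_evalAt P).mul (by fun_prop)).aestronglyMeasurable
  · rw [norm_mul, Real.norm_eq_abs, Real.norm_of_nonneg (Real.exp_pos _).le]
    refine (mul_le_mul_of_nonneg_right (h x) (Real.exp_pos _).le).trans ?_
    rw [mul_assoc, mul_assoc, ← Real.exp_add, ← Real.exp_add]
    refine mul_le_mul_of_nonneg_left (Real.exp_le_exp.2 ?_) hC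
    -- This is a‖x‖ ≤ a²/2 + ‖x‖²/2, which spends half of the Gaussian exponent.
    nlinarith [sq_nonneg (a - ‖x‖)]

/-- The Gaussian integral of a polynomial. -/
def gaussInt (P : MvPolynomial (Fin d) ℝ) : ℝ := ∫ x, evalAt P x * Real.exp (-‖x‖ ^ 2)

lemma gaussInt_add (P Q : MvPolynomial (Fin d) ℝ) :
    gaussInt (P + Q) = gaussInt P + gaussInt Q := by
  simp only [gaussInt, evalAt_add, add_mul]
  exact integral_add (integrable_evalAt_mul_gaussian P) (integrable_evalAt_mul_gaussian Q)

lemma gaussInt_smul (c : ℝ) (P : MvPolynomial (Fin d) ℝ) :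
    gaussInt (c • P) = c * gaussInt P := by
  simp [gaussInt, evalAt, mul_assoc, integral_const_mul]

/-- The Gaussian integral as a linear functional on polynomials. -/
def gaussLin (d : ℕ) : MvPolynomial (Fin d) ℝ →ₗ[ℝ] ℝ where
  toFun := gaussInt
  map_add' := gaussInt_add
  map_smul' := gaussInt_smul

/-- Integration by parts, with ∂_i exp(-‖x‖²) = -2 x_i exp(-‖x‖²). -/
lemma gaussLin_pderiv (i : Fin d) (P : MvPolynomial (Fin d) ℝ) :
    gaussLin d (pderiv i P) = 2 * gaussLin d (X i * P) := by
  have hG : ∀ x : EuclideanSpace ℝ (Fin d), HasFDerivAt (fun x => Real.exp (-‖x‖ ^ 2))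
      (Real.exp (-‖x‖ ^ 2) • -((2 : ℕ) • (innerSL ℝ x : EuclideanSpace ℝ (Fin d) →L[ℝ] ℝ))) x :=
    fun x =>
    (hasStrictFDerivAt_norm_sq x).hasFDerivAt.neg.exp
  have h1 : ∀ x, fderiv ℝ (evalAt P) x (EuclideanSpace.single i 1) = evalAt (pderiv i P) x := by
    intro x
    rw [(hasFDerivAt_evalAt P x).fderiv]
    simp
  have h2 : ∀ x : EuclideanSpace ℝ (Fin d), fderiv ℝ (fun x => Real.exp (-‖x‖ ^ 2)) x
      (EuclideanSpace.single i 1) = -2 * (x i * Real.exp (-‖x‖ ^ 2)) := by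
    intro x
    rw [(hG x).fderiv]
    simp [EuclideanSpace.inner_single_right]
    ring
  have h3 : ∀ x, evalAt (X i * P) x * Real.exp (-‖x‖ ^ 2) =
      evalAt P x * (x i * Real.exp (-‖x‖ ^ 2)) := fun x => by
    simp [evalAt]; ring
  have key := integral_mul_fderiv_eq_neg_fderiv_mul_of_integrable (μ := volume)
    (f := evalAt P) (g := fun x : EuclideanSpace ℝ (Fin d) => Real.exp (-‖x‖ ^ 2))
    (v := EuclideanSpace.single i 1) ?_ ?_ (integrable_evalAt_mul_gaussian P)
    (fun x _ => (hasFDerivAt_evalAt P x).differentiableAt) (fun x _ => (hG x).differentiableAt)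
  · simp only [h1, h2] at key
    simp only [gaussLin, LinearMap.coe_mk, AddHom.coe_mk, gaussInt, h3]
    rw [← neg_eq_iff_eq_neg] at key
    rw [← key, ← integral_neg, ← integral_const_mul]
    congr 1
    ext x
    ring
  · simpa only [h1] using integrable_evalAt_mul_gaussian (pderiv i P)
  · simp only [h2]
    refine ((integrable_evalAt_mul_gaussian (X i * P)).const_mul (-2)).congr
      (.of_forall fun x => ?_)
    simp only [h3]
    ring

/-- The left side integrates the divergence of P∇Q. By parts this becomes 2 ∫ P (x·∇Q), and Euler's
identity gives x·∇Q = k Q. -/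
lemma gaussLin_gradPoly {k : ℕ} (P : MvPolynomial (Fin d) ℝ) {Q : MvPolynomial (Fin d) ℝ}
    (hQ : Q.IsHomogeneous k) :
    gaussLin d (gradPoly P Q) + gaussLin d (P * laplacian d Q) = 2 * k * gaussLin d (P * Q) := by
  have h : gradPoly P Q + P * laplacian d Q = ∑ i, pderiv i (P * pderiv i Q) := by
    simp only [gradPoly, laplacian_apply, Finset.mul_sum, ← Finset.sum_add_distrib, pderiv_mul]
  rw [← map_add, h]
  simp only [map_sum, gaussLin_pderiv, ← Finset.mul_sum, mul_left_comm (X _) P]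
  rw [← map_sum, ← Finset.mul_sum, hQ.sum_X_mul_pderiv,
    mul_smul_comm, map_nsmul, nsmul_eq_mul, mul_assoc]

/-- The Gaussian integral of a homogeneous polynomial in polar coordinates. -/
lemma gaussLin_eq_sphereInt (hd : 1 ≤ d) {k : ℕ} {P : MvPolynomial (Fin d) ℝ}
    (hP : P.IsHomogeneous k) :
    gaussLin d P = 1 / 2 * Real.Gamma ((d + k : ℝ) / 2) * sphereInt P := by
  have h := integral_evalAt_mul_radial hd hP fun r => Real.exp (-r ^ 2)
  refine h.trans ?_
  congr 1
  rw [show ((d : ℝ) + k) / 2 = (((d - 1 + k : ℕ) : ℝ) + 1) / 2 by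
    push_cast [Nat.cast_sub hd]; ring,
    ← integral_rpow_mul_exp_neg_rpow two_pos (by linarith [Nat.cast_nonneg (α := ℝ) (d - 1 + k)])]
  simp only [Real.rpow_natCast, Real.rpow_two, pow_add, mul_assoc]

lemma gaussGamma_pos (hd : 1 ≤ d) (k : ℕ) : 0 < Real.Gamma ((d + k : ℝ) / 2) :=
  Real.Gamma_pos_of_pos (by
    have : (1 : ℝ) ≤ d := by exact_mod_cast hd
    positivity)

lemma gradPoly_comm (P Q : MvPolynomial (Fin d) ℝ) : gradPoly P Q = gradPoly Q P := by
  simp [gradPoly, mul_comm]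

lemma isHomogeneous_gradPoly {k l : ℕ} {P Q : MvPolynomial (Fin d) ℝ} (hP : P.IsHomogeneous k)
    (hQ : Q.IsHomogeneous l) : (gradPoly P Q).IsHomogeneous (k - 1 + (l - 1)) :=
  IsHomogeneous.sum _ _ _ fun _ _ => hP.pderiv.mul hQ.pderiv

lemma gaussLin_gradPoly_harmonic {l : ℕ} {P Q : MvPolynomial (Fin d) ℝ}
    (hQ : Q ∈ harmonicSpace d l) :
    gaussLin d (gradPoly P Q) = 2 * l * gaussLin d (P * Q) := by
  rw [← gaussLin_gradPoly P hQ.1, LinearMap.mem_ker.1 hQ.2]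
  simp

/-- The Gaussian integral of ∇P·∇Q is both 2l and 2k times that of P Q, so both integrals vanish;
the Gamma factors relating them to the sphere are nonzero. -/
lemma sphereInt_harmonic_mul_eq_zero (hd : 1 ≤ d) {k l : ℕ} (hkl : k ≠ l)
    {P Q : MvPolynomial (Fin d) ℝ} (hP : P ∈ harmonicSpace d k) (hQ : Q ∈ harmonicSpace d l) :
    sphereInt (P * Q) = 0 ∧ sphereInt (gradPoly P Q) = 0 := by
  have h1 := gaussLin_gradPoly_harmonic (P := P) hQ
  have h2 := gaussLin_gradPoly_harmonic (P := Q) hP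
  rw [gradPoly_comm, mul_comm Q] at h2
  have h3 : gaussLin d (P * Q) = 0 := by
    have h4 : (l - k : ℝ) * gaussLin d (P * Q) = 0 := by linear_combination (h2 - h1) / 2
    refine (mul_eq_zero.1 h4).resolve_left (sub_ne_zero.2 ?_)
    exact_mod_cast hkl.symm
  rw [h3, mul_zero] at h1
  rw [gaussLin_eq_sphereInt hd (isHomogeneous_gradPoly hP.1 hQ.1)] at h1
  rw [gaussLin_eq_sphereInt hd (IsHomogeneous.mul hP.1 hQ.1)] at h3
  exact ⟨(mul_eq_zero.1 h3).resolve_left (by have := gaussGamma_pos hd (k + l); positivity),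
    (mul_eq_zero.1 h1).resolve_left
      (by have := gaussGamma_pos hd (k - 1 + (l - 1)); positivity)⟩

lemma sphereInt_gradPoly (hd : 1 ≤ d) {m : ℕ} {P Q : MvPolynomial (Fin d) ℝ}
    (hP : P ∈ harmonicSpace d m) (hQ : Q ∈ harmonicSpace d m) :
    sphereInt (gradPoly P Q) = m * (2 * m + d - 2) * sphereInt (P * Q) := by
  have h1 := gaussLin_gradPoly_harmonic (P := P) hQ
  rw [gaussLin_eq_sphereInt hd (isHomogeneous_gradPoly hP.1 hQ.1),
    gaussLin_eq_sphereInt hd (IsHomogeneous.mul hP.1 hQ.1)] at h1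
  have hc := gaussGamma_pos hd (m - 1 + (m - 1))
  rcases m with _ | m
  · have := (mul_eq_zero.1 (h1.trans (by simp))).resolve_left (by positivity)
    simp [this]
  · have hd' : (1 : ℝ) ≤ d := by exact_mod_cast hd
    simp only [Nat.add_sub_cancel] at h1 hc
    -- The gradient product has degree two less than P Q, so the two Gamma factors differ by one
    -- step of the functional equation.
    have h2 : Real.Gamma ((d + (m + 1 + (m + 1) : ℕ) : ℝ) / 2) =
        ((d + (m + m : ℕ) : ℝ) / 2) * Real.Gamma ((d + (m + m : ℕ) : ℝ) / 2) := by
      rw [← Real.Gamma_add_one (by positivity)]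
      congr 1
      push_cast
      ring
    rw [h2] at h1
    refine mul_left_cancel₀ hc.ne' ?_
    push_cast at h1 ⊢
    linear_combination 2 * h1

end BallSobolev
end

/-! ### Jacobi integrals and the univariate Sobolev product. -/

noncomputable section
namespace BallSobolev
open Polynomial Set

lemma intervalIntegrable_jacobiWeight {α β : ℝ} (hα : -1 < α) (hβ : -1 < β) :
    IntervalIntegrable (jacobiWeight α β) volume (-1) 1 := by
  have h1 : ∀ a b : ℝ, IntervalIntegrable (fun t : ℝ => (1 - t) ^ α) volume a b := fun a b => by
    have := (intervalIntegral.intervalIntegrable_rpow' hα (a := 1 - a) (b := 1 - b)).comp_sub_left 1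
    simpa using this
  have h2 : ∀ a b : ℝ, IntervalIntegrable (fun t : ℝ => (1 + t) ^ β) volume a b := fun a b => by
    have := (intervalIntegral.intervalIntegrable_rpow' hβ (a := 1 + a) (b := 1 + b)).comp_add_left 1
    simpa using this
  refine IntervalIntegrable.trans (b := 0) ((h2 _ _).continuousOn_mul ?_)
    ((h1 _ _).mul_continuousOn ?_)
  · refine ContinuousOn.rpow_const (by fun_prop) fun t ht => Or.inl ?_
    rw [uIcc_of_le (by norm_num)] at ht
    linarith [ht.2]
  · refine ContinuousOn.rpow_const (by fun_prop) fun t ht => Or.inl ?_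
    rw [uIcc_of_le (by norm_num)] at ht
    linarith [ht.1]

/-- The integral of a polynomial against the Jacobi weight. -/
def jacobiInt (α β : ℝ) (p : ℝ[X]) : ℝ := ∫ t in (-1 : ℝ)..1, p.eval t * jacobiWeight α β t

lemma intervalIntegrable_eval_mul_jacobiWeight {α β : ℝ} (hα : -1 < α) (hβ : -1 < β) (p : ℝ[X]) :
    IntervalIntegrable (fun t => p.eval t * jacobiWeight α β t) volume (-1) 1 :=
  (intervalIntegrable_jacobiWeight hα hβ).continuousOn_mul p.continuous.continuousOn

lemma jacobiInt_add {α β : ℝ} (hα : -1 < α) (hβ : -1 < β) (p q : ℝ[X]) :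
    jacobiInt α β (p + q) = jacobiInt α β p + jacobiInt α β q := by
  simp only [jacobiInt, eval_add, add_mul]
  exact intervalIntegral.integral_add (intervalIntegrable_eval_mul_jacobiWeight hα hβ p)
    (intervalIntegrable_eval_mul_jacobiWeight hα hβ q)

lemma jacobiInt_C_mul (α β c : ℝ) (p : ℝ[X]) :
    jacobiInt α β (C c * p) = c * jacobiInt α β p := by
  simp [jacobiInt, mul_assoc]

lemma jacobiWeight_pos {α β t : ℝ} (ht : t ∈ Ioo (-1 : ℝ) 1) : 0 < jacobiWeight α β t :=
  mul_pos (Real.rpow_pos_of_pos (by linarith [ht.2]) _)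
    (Real.rpow_pos_of_pos (by linarith [ht.1]) _)

lemma jacobiInt_sq_pos {α β : ℝ} (hα : -1 < α) (hβ : -1 < β) {p : ℝ[X]} (hp : p ≠ 0) :
    0 < jacobiInt α β (p * p) := by
  rw [jacobiInt, intervalIntegral.integral_of_le (by norm_num), integral_Ioc_eq_integral_Ioo,
    setIntegral_pos_iff_support_of_nonneg_ae]
  · have hsub : Ioo (-1 : ℝ) 1 \ {t | p.IsRoot t} ⊆
        (Function.support fun t => (p * p).eval t * jacobiWeight α β t) ∩ Ioo (-1 : ℝ) 1 := by
      rintro t ⟨ht, hr⟩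
      exact ⟨mul_ne_zero (by simpa using hr) (jacobiWeight_pos ht).ne', ht⟩
    refine lt_of_lt_of_le ?_ (measure_mono hsub)
    rw [measure_sdiff_null ((p.finite_setOfPred_isRoot hp).measure_zero _)]
    simp
  · filter_upwards [ae_restrict_mem measurableSet_Ioo] with t ht
    rw [eval_mul]
    exact mul_nonneg (mul_self_nonneg _) (jacobiWeight_pos ht).le
  · exact ((intervalIntegrable_iff_integrableOn_Ioo_of_le (by norm_num)).1
      (intervalIntegrable_eval_mul_jacobiWeight hα hβ (p * p)))

/-- The change of variables `t = 2 r² - 1`. -/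
lemma integral_comp_two_mul_sq_sub_one (F : ℝ → ℝ) {μ β : ℝ} {e : ℕ} (he : (e : ℝ) = 2 * β + 1) :
    ∫ r in Ioo (0 : ℝ) 1, r ^ e * (F (2 * r ^ 2 - 1) * (1 - r ^ 2) ^ μ) =
      2 ^ (-(μ + β + 2)) * ∫ t in (-1 : ℝ)..1, F t * jacobiWeight μ β t := by
  have himg : (fun r : ℝ => 2 * r ^ 2 - 1) '' Ioo 0 1 = Ioo (-1) 1 := by
    ext t
    constructor
    · rintro ⟨r, ⟨h0, h1⟩, rfl⟩
      constructor <;> dsimp only <;> nlinarith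
    · rintro ⟨h0, h1⟩
      refine ⟨Real.sqrt ((1 + t) / 2), ⟨Real.sqrt_pos.2 (by linarith), ?_⟩, ?_⟩
      · rw [Real.sqrt_lt' one_pos]; linarith
      · dsimp only
        rw [Real.sq_sqrt (by linarith)]; ring
  have h := integral_image_eq_integral_abs_deriv_smul (f := fun r : ℝ => 2 * r ^ 2 - 1)
    (f' := fun r => 4 * r) (s := Ioo 0 1) measurableSet_Ioo
    (fun r _ => by
      have := (((hasDerivAt_pow 2 r).const_mul 2).sub_const 1).hasDerivWithinAt (s := Ioo 0 1)
      exact this.congr_deriv (by norm_num; ring))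
    (fun a ha b hb hab => by
      have h2 : a ^ 2 = b ^ 2 := by simp only at hab; linarith
      exact (pow_left_inj₀ ha.1.le hb.1.le two_ne_zero).1 h2)
    (fun t => F t * jacobiWeight μ β t)
  rw [himg] at h
  rw [intervalIntegral.integral_of_le (by norm_num), integral_Ioc_eq_integral_Ioo, h,
    ← integral_const_mul]
  refine setIntegral_congr_fun measurableSet_Ioo fun r hr => ?_
  have hr0 := hr.1
  have hr2 : 0 ≤ 1 - r ^ 2 := by nlinarith [hr.2]
  have e1 : (1 - (2 * r ^ 2 - 1)) = 2 * (1 - r ^ 2) := by ring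
  have e2 : (1 + (2 * r ^ 2 - 1)) = 2 * r ^ 2 := by ring
  have e3 : r ^ e = r * (r ^ 2) ^ β := by
    rw [← Real.rpow_natCast r e, he, Real.rpow_add hr0, Real.rpow_one, Real.rpow_mul hr0.le,
      Real.rpow_two, mul_comm]
  -- The Jacobian is 4r, and 1 - t = 2(1 - r²), 1 + t = 2r² contribute the other powers of 2.
  have e4 : (2 : ℝ) ^ (-(μ + β + 2)) * (4 * (2 ^ μ * 2 ^ β)) = 1 := by
    rw [← Real.rpow_add two_pos, show (4 : ℝ) = 2 ^ (2 : ℝ) by norm_num,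
      ← Real.rpow_add two_pos, ← Real.rpow_add two_pos]
    ring_nf
    simp
  simp only [jacobiWeight, e1, e2, e3, smul_eq_mul]
  rw [Real.mul_rpow two_pos.le hr2, Real.mul_rpow two_pos.le (sq_nonneg r),
    abs_of_pos (by linarith : 0 < 4 * r)]
  linear_combination -(r * (r ^ 2) ^ β * F (2 * r ^ 2 - 1) * (1 - r ^ 2) ^ μ) * e4

lemma integral_Ioo_rpow_mul_one_sub_rpow {u v : ℝ} (hu : 0 < u) (hv : 0 < v) :
    ∫ x in Ioo (0 : ℝ) 1, x ^ (u - 1) * (1 - x) ^ (v - 1) =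
      Real.Gamma u * Real.Gamma v / Real.Gamma (u + v) := by
  have h := ProbabilityTheory.beta_eq_betaIntegralReal u v hu hv
  rw [ProbabilityTheory.beta] at h
  rw [h, Complex.betaIntegral, intervalIntegral.integral_of_le (by norm_num),
      ← integral_Ioc_eq_integral_Ioo, ← RCLike.re_to_complex, ← integral_re]
  · refine setIntegral_congr_fun measurableSet_Ioc fun x ⟨hx1, hx₂⟩ ↦ ?_
    norm_cast
    rw [← Complex.ofReal_cpow, ← Complex.ofReal_cpow, RCLike.re_to_complex,
      Complex.re_mul_ofReal, Complex.ofReal_re]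
    all_goals linarith
  · have := Complex.betaIntegral_convergent (u := u) (v := v) (by simpa) (by simpa)
    rwa [intervalIntegrable_iff_integrableOn_Ioc_of_le (by simp), IntegrableOn] at this

lemma integral_jacobiWeight {α β : ℝ} (hα : -1 < α) (hβ : -1 < β) :
    ∫ t in (-1 : ℝ)..1, jacobiWeight α β t = 2 ^ (α + β + 1) *
      (Real.Gamma (β + 1) * Real.Gamma (α + 1) / Real.Gamma (β + α + 2)) := by
  have h : ∫ t in (0 : ℝ)..1, jacobiWeight α β (2 * t + -1) =
      2⁻¹ * ∫ t in (-1 : ℝ)..1, jacobiWeight α β t := by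
    rw [intervalIntegral.integral_comp_mul_add _ two_ne_zero]
    norm_num
  have h2 : ∫ t in (0 : ℝ)..1, jacobiWeight α β (2 * t + -1) =
      2 ^ (α + β) * ∫ x in Ioo (0 : ℝ) 1, x ^ (β + 1 - 1) * (1 - x) ^ (α + 1 - 1) := by
    rw [intervalIntegral.integral_of_le (by norm_num), integral_Ioc_eq_integral_Ioo,
      ← integral_const_mul]
    refine setIntegral_congr_fun measurableSet_Ioo fun x hx => ?_
    simp only [jacobiWeight, add_sub_cancel_right]
    rw [show 1 - (2 * x + -1) = 2 * (1 - x) by ring, show 1 + (2 * x + -1) = 2 * x by ring,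
      Real.mul_rpow two_pos.le (by linarith [hx.2]), Real.mul_rpow two_pos.le hx.1.le,
      Real.rpow_add two_pos]
    ring
  rw [integral_Ioo_rpow_mul_one_sub_rpow (by linarith) (by linarith)] at h2
  rw [h2] at h
  rw [Real.rpow_add_one two_ne_zero]
  rw [show β + 1 + (α + 1) = β + α + 2 by ring] at h
  linarith

/-- The parameter `β = m + (d - 2) / 2` that belongs to harmonics of degree `m`. -/
def harmIdx (d m : ℕ) : ℝ := m + ((d : ℝ) - 2) / 2

lemma neg_one_lt_harmIdx {d : ℕ} (hd : 1 ≤ d) (m : ℕ) : -1 < harmIdx d m := by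
  have : (1 : ℝ) ≤ d := by exact_mod_cast hd
  have : (0 : ℝ) ≤ m := by positivity
  unfold harmIdx
  linarith

lemma harmIdx_pos {d m : ℕ} (hd : 1 ≤ d) (hm : m ≠ 0) : 0 < harmIdx d m := by
  have : (1 : ℝ) ≤ d := by exact_mod_cast hd
  have : (1 : ℝ) ≤ m := by exact_mod_cast Nat.one_le_iff_ne_zero.2 hm
  unfold harmIdx
  linarith

lemma coefB_harmIdx (d m : ℕ) : coefB d (harmIdx d m) = 2 * m := by
  unfold coefB harmIdx; ring

lemma coefA_harmIdx (d m : ℕ) : coefA d (harmIdx d m) = m * (2 * m + d - 2) := by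
  rw [coefA, coefB_harmIdx, harmIdx]; ring

/-- The part of the gradient integrand that is integrated against the Jacobi weight itself. -/
def gradIntegrand (m : ℕ) (f g : ℝ[X]) : ℝ[X] :=
  C 8 * ((1 + X) * (derivative f * derivative g)) +
    C (4 * m : ℝ) * (derivative f * g + f * derivative g)

lemma one_add_mul_jacobiWeight {α β t : ℝ} (ht : -1 < t) :
    (1 + t) * jacobiWeight α (β - 1) t = jacobiWeight α β t := by
  have h : (1 + t) ^ β = (1 + t) ^ (β - 1) * (1 + t) := by
    rw [← Real.rpow_add_one (by linarith), sub_add_cancel]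
  rw [jacobiWeight, jacobiWeight, h]
  ring

/-- For m = 0 the exponent β-1 can be -1 or less, and the weight alone need not be integrable. The
coefficient A then vanishes, so A is kept attached to this integral throughout. -/
lemma intervalIntegrable_coefA_mul {d : ℕ} (hd : 1 ≤ d) {μ : ℝ} (hμ : -1 < μ) (m : ℕ) (p : ℝ[X]) :
    IntervalIntegrable (fun t => coefA d (harmIdx d m) *
      (p.eval t * jacobiWeight μ (harmIdx d m - 1) t)) volume (-1) 1 := by
  rcases eq_or_ne m 0 with rfl | hm
  · simp [coefA_harmIdx]
  · exact (intervalIntegrable_eval_mul_jacobiWeight hμ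
      (by linarith [harmIdx_pos hd hm]) p).const_mul _

lemma coefA_mul_jacobiInt_add {d : ℕ} (hd : 1 ≤ d) {μ : ℝ} (hμ : -1 < μ) (m : ℕ) (p q : ℝ[X]) :
    coefA d (harmIdx d m) * jacobiInt μ (harmIdx d m - 1) (p + q) =
      coefA d (harmIdx d m) * jacobiInt μ (harmIdx d m - 1) p +
        coefA d (harmIdx d m) * jacobiInt μ (harmIdx d m - 1) q := by
  rcases eq_or_ne m 0 with rfl | hm
  · simp [coefA_harmIdx]
  · rw [jacobiInt_add hμ (by linarith [harmIdx_pos hd hm]), mul_add]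

/-- All matrix entries except A carry a factor 1+t, which raises the weight exponent from β-1 to β.
This is the form in which the ball integrals arrive. -/
lemma uniInner_eq {d : ℕ} (hd : 1 ≤ d) {μ : ℝ} (hμ : -1 < μ) (lam : ℝ) (m : ℕ) (f g : ℝ[X]) :
    uniInner d lam μ (harmIdx d m) f g = jacobiInt μ (harmIdx d m) (f * g) +
      lam * (jacobiInt μ (harmIdx d m) (gradIntegrand m f g) +
        2 * (coefA d (harmIdx d m) * jacobiInt μ (harmIdx d m - 1) (f * g))) := by
  have hβ := neg_one_lt_harmIdx hd m
  have h : ∫ t in (-1 : ℝ)..1, (![f.eval t, f.derivative.eval t] ⬝ᵥ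
        Matrix.mulVec (sobolevMatrix d (harmIdx d m) t) ![g.eval t, g.derivative.eval t]) *
        jacobiWeight μ (harmIdx d m - 1) t =
      1 / 2 * jacobiInt μ (harmIdx d m) (gradIntegrand m f g) +
        coefA d (harmIdx d m) * jacobiInt μ (harmIdx d m - 1) (f * g) := by
    rw [jacobiInt, jacobiInt, ← intervalIntegral.integral_const_mul,
      ← intervalIntegral.integral_const_mul, ← intervalIntegral.integral_add
        ((intervalIntegrable_eval_mul_jacobiWeight hμ hβ _).const_mul _)
        (intervalIntegrable_coefA_mul hd hμ m _)]
    rw [intervalIntegral.integral_of_le (by norm_num), intervalIntegral.integral_of_le (by norm_num)]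
    refine setIntegral_congr_fun measurableSet_Ioc fun t ht => ?_
    simp only [← one_add_mul_jacobiWeight (α := μ) (β := harmIdx d m) ht.1]
    simp [sobolevMatrix, gradIntegrand, Matrix.mulVec, dotProduct, Fin.sum_univ_two, coefB_harmIdx]
    ring
  rw [uniInner, h]
  simp only [jacobiInt, eval_mul]
  ring

lemma uniInner_comm (d : ℕ) (lam α β : ℝ) (f g : ℝ[X]) :
    uniInner d lam α β f g = uniInner d lam α β g f := by
  simp only [uniInner]
  congr 1
  · simp only [mul_comm (f.eval _)]
  · congr 1
    refine intervalIntegral.integral_congr fun t _ => ?_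
    congr 1
    simp [sobolevMatrix, Matrix.mulVec, dotProduct, Fin.sum_univ_two]
    ring

/-- The univariate Sobolev inner product as a bilinear form. -/
def uniForm {d : ℕ} (hd : 1 ≤ d) {μ : ℝ} (hμ : -1 < μ) (lam : ℝ) (m : ℕ) :
    LinearMap.BilinForm ℝ ℝ[X] :=
  have hadd : ∀ f f' g, uniInner d lam μ (harmIdx d m) (f + f') g =
      uniInner d lam μ (harmIdx d m) f g + uniInner d lam μ (harmIdx d m) f' g := fun f f' g => by
    have hβ := neg_one_lt_harmIdx hd m
    have e : gradIntegrand m (f + f') g = gradIntegrand m f g + gradIntegrand m f' g := by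
      simp only [gradIntegrand, map_add]; ring
    rw [uniInner_eq hd hμ, uniInner_eq hd hμ, uniInner_eq hd hμ, e, add_mul,
      jacobiInt_add hμ hβ, jacobiInt_add hμ hβ, coefA_mul_jacobiInt_add hd hμ]
    ring
  have hsmul : ∀ (c : ℝ) (f g), uniInner d lam μ (harmIdx d m) (c • f) g =
      c • uniInner d lam μ (harmIdx d m) f g := fun c f g => by
    have e : gradIntegrand m (c • f) g = C c * gradIntegrand m f g := by
      simp only [gradIntegrand, smul_eq_C_mul, derivative_C_mul]; ring
    rw [uniInner_eq hd hμ, uniInner_eq hd hμ, e, smul_eq_C_mul, mul_assoc, jacobiInt_C_mul,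
      jacobiInt_C_mul, jacobiInt_C_mul, smul_eq_mul]
    ring
  LinearMap.mk₂ ℝ (uniInner d lam μ (harmIdx d m)) hadd hsmul
    (fun f g g' => by simp only [uniInner_comm d lam μ _ f]; exact hadd g g' f)
    (fun c f g => by simp only [uniInner_comm d lam μ _ f]; exact hsmul c g f)

/-- Completing the square leaves the coefficient m(m+d-2), which is nonnegative for every natural m
because d ≥ 1. -/
lemma sobolevMatrix_nonneg {d : ℕ} (hd : 1 ≤ d) (m : ℕ) (t x y : ℝ) :
    0 ≤ ![x, y] ⬝ᵥ Matrix.mulVec (sobolevMatrix d (harmIdx d m) t) ![x, y] := by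
  have h : ![x, y] ⬝ᵥ Matrix.mulVec (sobolevMatrix d (harmIdx d m) t) ![x, y] =
      m * (m + d - 2) * x ^ 2 + (m * x + 2 * (1 + t) * y) ^ 2 := by
    simp [sobolevMatrix, Matrix.mulVec, dotProduct, Fin.sum_univ_two, coefB_harmIdx, coefA_harmIdx]
    ring
  have hd' : (1 : ℝ) ≤ d := by exact_mod_cast hd
  have h2 : (0 : ℝ) ≤ m * (m + d - 2) := by
    rcases eq_or_ne m 0 with rfl | hm
    · simp
    · have : (1 : ℝ) ≤ m := by exact_mod_cast Nat.one_le_iff_ne_zero.2 hm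
      exact mul_nonneg (by positivity) (by linarith)
  rw [h]
  positivity

lemma uniInner_self_pos {d : ℕ} (hd : 1 ≤ d) {lam μ : ℝ} (hlam : 0 < lam) (hμ : -1 < μ) (m : ℕ)
    {f : ℝ[X]} (hf : f ≠ 0) : 0 < uniInner d lam μ (harmIdx d m) f f := by
  refine add_pos_of_pos_of_nonneg ?_ (mul_nonneg (by positivity) ?_)
  · simpa [jacobiInt] using jacobiInt_sq_pos hμ (neg_one_lt_harmIdx hd m) hf
  · rw [intervalIntegral.integral_of_le (by norm_num), integral_Ioc_eq_integral_Ioo]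
    exact setIntegral_nonneg measurableSet_Ioo fun t ht =>
      mul_nonneg (sobolevMatrix_nonneg hd m t _ _) (jacobiWeight_pos ht).le

/-- Positivity makes B nondegenerate on polynomials of degree below j, so the term c X^j has exactly
one lower-order correction w. For uniqueness, the difference of two solutions has degree below j and
is orthogonal to itself. -/
lemma existsUnique_orthogonal_polynomial (B : LinearMap.BilinForm ℝ ℝ[X])
    (hB : ∀ p, p ≠ 0 → 0 < B p p) (j : ℕ) {c : ℝ} (hc : c ≠ 0) :
    ∃! p : ℝ[X], p.natDegree = j ∧ p.leadingCoeff = c ∧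
      ∀ g : ℝ[X], g.degree < (j : WithBot ℕ) → B p g = 0 := by
  let W := degreeLT ℝ j
  have : FiniteDimensional ℝ W := (degreeLTEquiv ℝ j).symm.finiteDimensional
  let T : W →ₗ[ℝ] Module.Dual ℝ W := (B.restrict W)
  have hT : Function.Injective T := by
    rw [← LinearMap.ker_eq_bot, LinearMap.ker_eq_bot']
    intro p hp
    by_contra hne
    have h1 := hB p (by simpa using hne)
    have h2 : T p p = 0 := by rw [hp]; rfl
    exact h1.ne' h2
  have hsurj := (LinearMap.injective_iff_surjective_of_finrank_eq_finrank
    (Subspace.dual_finrank_eq (K := ℝ) (V := W)).symm).1 hT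
  obtain ⟨w, hw⟩ := hsurj (-(B (C c * X ^ j)).domRestrict W)
  have hwd : (w : ℝ[X]).degree < j := mem_degreeLT.1 w.2
  have hdeg : (C c * X ^ j : ℝ[X]).degree = j := degree_C_mul_X_pow j hc
  have hlt : (w : ℝ[X]).degree < (C c * X ^ j : ℝ[X]).degree := by rwa [hdeg]
  refine ⟨C c * X ^ j + (w : ℝ[X]), ⟨?_, ?_, ?_⟩, ?_⟩
  · exact natDegree_eq_of_degree_eq_some (by rw [degree_add_eq_left_of_degree_lt hlt, hdeg])
  · rw [leadingCoeff_add_of_degree_lt' hlt, leadingCoeff_C_mul_X_pow]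
  · intro g hg
    have h := LinearMap.congr_fun hw ⟨g, mem_degreeLT.2 hg⟩
    have h' : B (w : ℝ[X]) g = -(B (C c * X ^ j) g) := h
    rw [map_add, LinearMap.add_apply, h', add_neg_cancel]
  · rintro p ⟨hp1, hp2, hp3⟩
    have hp0 : p ≠ 0 := by
      rintro rfl
      exact hc (by simpa using hp2.symm)
    have hp4 : p.degree = j := by rw [degree_eq_natDegree hp0, hp1]
    have hsub : (p - (C c * X ^ j + (w : ℝ[X]))).degree < (j : WithBot ℕ) := by
      rw [← hp4]
      refine degree_sub_lt_left ?_ hp0 ?_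
      · rw [hp4, degree_add_eq_left_of_degree_lt hlt, hdeg]
      · rw [hp2, leadingCoeff_add_of_degree_lt' hlt, leadingCoeff_C_mul_X_pow]
    by_contra hne
    refine (hB _ (sub_ne_zero.2 hne)).ne' ?_
    have h := LinearMap.congr_fun hw ⟨_, mem_degreeLT.2 hsub⟩
    have h' : B (w : ℝ[X]) (p - (C c * X ^ j + (w : ℝ[X]))) =
        -(B (C c * X ^ j) (p - (C c * X ^ j + (w : ℝ[X])))) := h
    have h'' : ∀ r, B (p - (C c * X ^ j + (w : ℝ[X]))) r =
        B p r - (B (C c * X ^ j) r + B (w : ℝ[X]) r) := fun r => by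
      simp only [map_sub, map_add, LinearMap.sub_apply, LinearMap.add_apply]
    rw [h'', h', hp3 _ hsub]
    ring

lemma jacobiLead_ne_zero {d : ℕ} (hd : 1 ≤ d) {μ : ℝ} (hμ : -1 < μ) (j m : ℕ) :
    jacobiLead j μ (harmIdx d m) ≠ 0 := by
  rcases Nat.eq_zero_or_pos j with rfl | hj
  · simp [jacobiLead]
  have hj' : (1 : ℝ) ≤ j := by exact_mod_cast hj
  have hd' : (1 : ℝ) ≤ d := by exact_mod_cast hd
  -- Every factor is positive: 2j + μ + β > j - 1, since j ≥ 1, μ > -1 and β ≥ -1/2.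
  have h1 : (0 : ℝ) < (descPochhammer ℝ j).eval (2 * (j : ℝ) + μ + harmIdx d m) := by
    refine descPochhammer_pos ?_
    have : (0 : ℝ) ≤ m := by positivity
    unfold harmIdx
    linarith
  refine mul_ne_zero (by positivity) fun h => h1.ne' ?_
  have h2 := Ring.descPochhammer_eq_factorial_smul_choose (2 * (j : ℝ) + μ + harmIdx d m) j
  rw [h, smul_zero, ← aeval_eq_smeval, ← eval_map_algebraMap, algebraMap_int_eq,
    descPochhammer_map] at h2
  exact h2

theorem existsUnique_isSobolevOP {d : ℕ} (hd : 1 ≤ d) {lam μ : ℝ} (hlam : 0 < lam) (hμ : -1 < μ)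
    (j m : ℕ) : ∃! p : ℝ[X], IsSobolevOP d lam μ (harmIdx d m) j p := by
  obtain ⟨p, ⟨h1, h2, h3⟩, hu⟩ := existsUnique_orthogonal_polynomial (uniForm hd hμ lam m)
    (fun p hp => uniInner_self_pos hd hlam hμ m hp) j (jacobiLead_ne_zero hd hμ j m)
  exact ⟨p, ⟨h1, h2, h3⟩, fun q hq => hu q ⟨hq.1, hq.2, hq.3⟩⟩

end BallSobolev
end

/-! ### The Sobolev product on the ball, evaluated on radial times harmonic polynomials. -/

noncomputable section
namespace BallSobolev
open MvPolynomial Set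

variable {d : ℕ}

lemma integrableOn_ballWeight (hd : 1 ≤ d) {μ : ℝ} (hμ : -1 < μ) :
    IntegrableOn (ballWeight d μ) (Metric.closedBall 0 1) := by
  have hfr : Module.finrank ℝ (EuclideanSpace ℝ (Fin d)) = d := by simp
  have : Nontrivial (EuclideanSpace ℝ (Fin d)) :=
    Module.nontrivial_of_finrank_pos (R := ℝ) (by omega)
  have hae : (Metric.closedBall (0 : EuclideanSpace ℝ (Fin d)) 1 : Set _) =ᵐ[volume]
      Metric.ball 0 1 := by
    rw [← Metric.ball_union_sphere]
    exact union_ae_eq_left_of_ae_eq_empty (ae_eq_empty.2 (Measure.addHaar_sphere _ _ _))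
  rw [integrableOn_congr_set_ae hae]
  refine (integrableOn_fun_norm_addHaar volume (f := fun r : ℝ => (1 - r ^ 2) ^ μ)).2 ?_
  rw [← intervalIntegrable_iff_integrableOn_Ioo_of_le zero_le_one]
  have h1 : IntervalIntegrable (fun r : ℝ => (1 - r) ^ μ) volume 0 1 := by
    have := (intervalIntegral.intervalIntegrable_rpow' hμ (a := 1) (b := 0)).comp_sub_left 1
    simpa using this
  have h2 := h1.continuousOn_mul (g := fun r : ℝ =>
    r ^ (Module.finrank ℝ (EuclideanSpace ℝ (Fin d)) - 1) * (1 + r) ^ μ) <| by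
      refine ContinuousOn.mul (by fun_prop) (ContinuousOn.rpow_const (by fun_prop) fun t ht => ?_)
      rw [uIcc_of_le zero_le_one] at ht
      left; linarith [ht.1]
  refine h2.congr fun r hr => ?_
  rw [uIoc_of_le zero_le_one] at hr
  -- Only the factor (1-r)^μ can be singular on [0, 1].
  have e : 1 - r ^ 2 = (1 + r) * (1 - r) := by ring
  simp only [smul_eq_mul, e]
  rw [Real.mul_rpow (by linarith [hr.1]) (by linarith [hr.2])]
  ring

lemma integrableOn_evalAt_mul_ballWeight (hd : 1 ≤ d) {μ : ℝ} (hμ : -1 < μ)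
    (P : MvPolynomial (Fin d) ℝ) :
    IntegrableOn (fun x => evalAt P x * ballWeight d μ x) (Metric.closedBall 0 1) :=
  (integrableOn_ballWeight hd hμ).continuousOn_mul (continuous_evalAt P).continuousOn
    (isCompact_closedBall _ _)

/-- The integral of a polynomial over the ball against the weight `W_μ`. -/
def ballInt (μ : ℝ) (P : MvPolynomial (Fin d) ℝ) : ℝ :=
  ∫ x in Metric.closedBall (0 : EuclideanSpace ℝ (Fin d)) 1, evalAt P x * ballWeight d μ x

lemma ballInt_add (hd : 1 ≤ d) {μ : ℝ} (hμ : -1 < μ) (P Q : MvPolynomial (Fin d) ℝ) :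
    ballInt μ (P + Q) = ballInt μ P + ballInt μ Q := by
  simp only [ballInt, evalAt_add, add_mul]
  exact integral_add (integrableOn_evalAt_mul_ballWeight hd hμ P)
    (integrableOn_evalAt_mul_ballWeight hd hμ Q)

lemma ballInt_smul (μ c : ℝ) (P : MvPolynomial (Fin d) ℝ) :
    ballInt μ (c • P) = c * ballInt μ P := by
  simp [ballInt, evalAt, mul_assoc, integral_const_mul]

lemma gradDot_eq (f g : MvPolynomial (Fin d) ℝ) (x : EuclideanSpace ℝ (Fin d)) :
    gradDot f g x = evalAt (gradPoly f g) x := by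
  simp [gradDot, gradPoly, evalAt]

lemma ballInner_eq (μ lam : ℝ) (f g : MvPolynomial (Fin d) ℝ) :
    ballInner d μ lam f g =
      ballConst d μ * (ballInt μ (f * g) + lam * ballInt μ (gradPoly f g)) := by
  simp only [ballInner, ballInt, gradDot_eq, evalAt_mul]

lemma ballInner_comm (μ lam : ℝ) (f g : MvPolynomial (Fin d) ℝ) :
    ballInner d μ lam f g = ballInner d μ lam g f := by
  rw [ballInner_eq, ballInner_eq, mul_comm f, gradPoly_comm]

/-- The Sobolev inner product on the ball as a bilinear form. -/
def ballForm (hd : 1 ≤ d) {μ : ℝ} (hμ : -1 < μ) (lam : ℝ) :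
    LinearMap.BilinForm ℝ (MvPolynomial (Fin d) ℝ) :=
  have hadd : ∀ f f' g, ballInner d μ lam (f + f') g =
      ballInner d μ lam f g + ballInner d μ lam f' g := fun f f' g => by
    have e : gradPoly (f + f') g = gradPoly f g + gradPoly f' g := by
      simp [gradPoly, add_mul, Finset.sum_add_distrib]
    rw [ballInner_eq, ballInner_eq, ballInner_eq, e, add_mul, ballInt_add hd hμ, ballInt_add hd hμ]
    ring
  have hsmul : ∀ (c : ℝ) (f g), ballInner d μ lam (c • f) g =
      c • ballInner d μ lam f g := fun c f g => by
    have e : gradPoly (c • f) g = c • gradPoly f g := by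
      simp [gradPoly, Finset.smul_sum]
    rw [ballInner_eq, ballInner_eq, e, smul_mul_assoc, ballInt_smul, ballInt_smul, smul_eq_mul]
    ring
  LinearMap.mk₂ ℝ (ballInner d μ lam) hadd hsmul
    (fun f g g' => by simp only [ballInner_comm μ lam f]; exact hadd g g' f)
    (fun c f g => by simp only [ballInner_comm μ lam f]; exact hsmul c g f)

lemma ballForm_apply (hd : 1 ≤ d) {μ : ℝ} (hμ : -1 < μ) (lam : ℝ)
    (f g : MvPolynomial (Fin d) ℝ) : ballForm hd hμ lam f g = ballInner d μ lam f g := rfl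

/-- The radial integrand carries r^(d-1+k), and the relation between k and β makes this r^(2β+1), as
the substitution t = 2r²-1 requires. -/
lemma ballInt_ballPoly (hd : 1 ≤ d) {k : ℕ} {P : MvPolynomial (Fin d) ℝ} (hP : P.IsHomogeneous k)
    (q : Polynomial ℝ) {μ β : ℝ} (hβ : (d : ℝ) + k = 2 * β + 2) :
    ballInt μ (ballPoly q P) = 2 ^ (-(μ + β + 2)) * jacobiInt μ β q * sphereInt P := by
  have he : ((d - 1 + k : ℕ) : ℝ) = 2 * β + 1 := by
    push_cast [Nat.cast_sub hd]
    linarith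
  rw [jacobiInt, ← integral_comp_two_mul_sq_sub_one _ he,
    ← setIntegral_closedBall_evalAt_mul_radial hd hP
      fun r => q.eval (2 * r ^ 2 - 1) * (1 - r ^ 2) ^ μ]
  simp only [ballInt, evalAt_ballPoly, ballWeight]
  congr 1
  ext x
  ring

lemma ballPoly_mul_ballPoly (p q : Polynomial ℝ) (Y Z : MvPolynomial (Fin d) ℝ) :
    ballPoly p Y * ballPoly q Z = ballPoly (p * q) (Y * Z) := by
  simp only [ballPoly, map_mul]
  ring

lemma pderiv_ballPoly (q : Polynomial ℝ) (Y : MvPolynomial (Fin d) ℝ) (i : Fin d) :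
    pderiv i (ballPoly q Y) =
      4 * X i * ballPoly (Polynomial.derivative q) Y + ballPoly q (pderiv i Y) := by
  have h1 : pderiv i (2 * normSq d - 1) = 4 * X i := by
    rw [map_sub, Derivation.map_one_eq_zero, sub_zero,
      show (2 : MvPolynomial (Fin d) ℝ) = C 2 from (map_ofNat C 2).symm, pderiv_C_mul,
      pderiv_normSq, show (4 : MvPolynomial (Fin d) ℝ) = C 4 from
      (map_ofNat C 4).symm, show (2 : MvPolynomial (Fin d) ℝ) = C 2 from (map_ofNat C 2).symm,
      ← mul_assoc, ← C_mul]
    norm_num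
  have h2 : pderiv i (Polynomial.aeval (2 * normSq d - 1) q) =
      Polynomial.aeval (2 * normSq d - 1) (Polynomial.derivative q) * (4 * X i) := by
    rw [← h1]
    induction q using Polynomial.induction_on' with
    | add p q hp hq => simp only [map_add, hp, hq, add_mul]
    | monomial k a =>
      rw [Polynomial.aeval_monomial, Polynomial.derivative_monomial, Polynomial.aeval_monomial,
        algebraMap_eq, pderiv_C_mul, pderiv_pow, C_mul, map_natCast]
      ring
  change pderiv i (Polynomial.aeval (2 * normSq d - 1) q * Y) = _
  rw [pderiv_mul, h2]
  simp only [ballPoly, normSq]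
  ring

/-- With s = 2‖x‖²-1 one has ∇p(s) = 4p'(s)x. The square term 16‖x‖² p'q' becomes 8(1+s) p'q', and
Euler's identity evaluates the two cross terms. -/
lemma gradPoly_ballPoly {k l : ℕ} (p q : Polynomial ℝ) {Y Z : MvPolynomial (Fin d) ℝ}
    (hY : Y.IsHomogeneous k) (hZ : Z.IsHomogeneous l) :
    gradPoly (ballPoly p Y) (ballPoly q Z) =
      ballPoly (Polynomial.C 8 * ((1 + Polynomial.X) *
          (Polynomial.derivative p * Polynomial.derivative q)) +
        (Polynomial.C (4 * l : ℝ) * (Polynomial.derivative p * q) +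
          Polynomial.C (4 * k : ℝ) * (p * Polynomial.derivative q))) (Y * Z) +
      ballPoly (p * q) (gradPoly Y Z) := by
  let s : MvPolynomial (Fin d) ℝ := 2 * normSq d - 1
  let a (p : Polynomial ℝ) : MvPolynomial (Fin d) ℝ := Polynomial.aeval s p
  have h : gradPoly (ballPoly p Y) (ballPoly q Z) =
      16 * (a p.derivative * a q.derivative * Y * Z) * ∑ i, X i ^ 2 +
      4 * (a p.derivative * a q * Y) * ∑ i, X i * pderiv i Z +
      4 * (a p * a q.derivative * Z) * ∑ i, X i * pderiv i Y +
      a p * a q * gradPoly Y Z := by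
    simp only [gradPoly, pderiv_ballPoly, Finset.mul_sum, ← Finset.sum_add_distrib]
    refine Finset.sum_congr rfl fun i _ => ?_
    simp only [ballPoly, a, s, normSq]
    ring
  rw [h, hY.sum_X_mul_pderiv, hZ.sum_X_mul_pderiv]
  have hn : (∑ i, X i ^ 2 : MvPolynomial (Fin d) ℝ) = normSq d := rfl
  have hb : ∀ (p : Polynomial ℝ) (Y : MvPolynomial (Fin d) ℝ), ballPoly p Y = a p * Y :=
    fun _ _ => rfl
  rw [hn, hb, hb]
  simp only [a, map_add, map_mul, Polynomial.aeval_X, map_one, s,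
    nsmul_eq_mul, map_ofNat, map_natCast]
  ring

lemma ballInner_ballPoly_of_ne (hd : 1 ≤ d) {k l : ℕ} (hkl : k ≠ l) {μ : ℝ} (hμ : -1 < μ)
    (lam : ℝ) (p q : Polynomial ℝ) {Y Z : MvPolynomial (Fin d) ℝ} (hY : Y ∈ harmonicSpace d k)
    (hZ : Z ∈ harmonicSpace d l) : ballInner d μ lam (ballPoly p Y) (ballPoly q Z) = 0 := by
  obtain ⟨h1, h2⟩ := sphereInt_harmonic_mul_eq_zero hd hkl hY hZ
  -- The value of β is immaterial here, since the spherical factors vanish.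
  have hβ : ∀ k : ℕ, (d : ℝ) + k = 2 * (((d : ℝ) + k - 2) / 2) + 2 := fun k => by ring
  rw [ballInner_eq, ballPoly_mul_ballPoly, gradPoly_ballPoly p q hY.1 hZ.1, ballInt_add hd hμ,
    ballInt_ballPoly hd (IsHomogeneous.mul hY.1 hZ.1) _ (hβ _),
    ballInt_ballPoly hd (IsHomogeneous.mul hY.1 hZ.1) _ (hβ _),
    ballInt_ballPoly hd (isHomogeneous_gradPoly hY.1 hZ.1) _ (hβ _), h1, h2]
  simp

/-- The factorization applied to the constant 1 leaves a Beta integral. -/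
lemma inv_ballConst (hd : 1 ≤ d) {μ : ℝ} (hμ : -1 < μ) :
    (ballConst d μ)⁻¹ = 1 / 2 * (Real.Gamma (d / 2 : ℝ) * Real.Gamma (μ + 1) /
      Real.Gamma (μ + 1 + (d : ℝ) / 2)) * (surfaceMeasure d).real univ := by
  have h := ballInt_ballPoly hd (isHomogeneous_one (Fin d) ℝ) 1 (μ := μ) (β := harmIdx d 0)
    (by simp [harmIdx]; ring)
  have h1 : ballInt μ (ballPoly 1 (1 : MvPolynomial (Fin d) ℝ)) = (ballConst d μ)⁻¹ := by
    simp [ballInt, ballConst, ballPoly, evalAt]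
  have h2 : sphereInt (1 : MvPolynomial (Fin d) ℝ) = (surfaceMeasure d).real univ := by
    simp [sphereInt, evalAt]
  have h3 : jacobiInt μ (harmIdx d 0) 1 = ∫ t in (-1 : ℝ)..1, jacobiWeight μ (harmIdx d 0) t := by
    simp [jacobiInt]
  rw [h1, h2, h3, integral_jacobiWeight hμ (neg_one_lt_harmIdx hd 0), ← mul_assoc,
    ← Real.rpow_add two_pos] at h
  rw [h]
  congr 2
  · rw [show -(μ + harmIdx d 0 + 2) + (μ + harmIdx d 0 + 1) = -1 by ring, Real.rpow_neg_one]
    norm_num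
  · rw [harmIdx]
    congr 2
    · congr 1
      push_cast; ring
    · push_cast; ring_nf

lemma ballInner_ballPoly (hd : 1 ≤ d) {m : ℕ} {μ : ℝ} (hμ : -1 < μ)
    (lam : ℝ) (p q : Polynomial ℝ) {Y Z : MvPolynomial (Fin d) ℝ} (hY : Y ∈ harmonicSpace d m)
    (hZ : Z ∈ harmonicSpace d m) :
    ballInner d μ lam (ballPoly p Y) (ballPoly q Z) =
      Real.Gamma (μ + 1 + (d : ℝ) / 2) /
          (Real.Gamma (μ + 1) * Real.Gamma ((d : ℝ) / 2) * 2 ^ (harmIdx d m + μ + 1)) *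
          uniInner d lam μ (harmIdx d m) p q * sphereInner d Y Z := by
  have hgrad : ballInt μ (ballPoly (p * q) (gradPoly Y Z)) =
      2 ^ (-(μ + harmIdx d m + 2)) * (2 * (coefA d (harmIdx d m) *
        jacobiInt μ (harmIdx d m - 1) (p * q))) * sphereInt (Y * Z) := by
    have hs := sphereInt_gradPoly hd hY hZ
    rw [← coefA_harmIdx] at hs
    rcases eq_or_ne m 0 with rfl | hm
    -- For m = 0 truncated subtraction gives the gradient product degree 0 instead of -2, so β is
    -- not lowered; both sides vanish because A = 0.
    · rw [ballInt_ballPoly hd (isHomogeneous_gradPoly hY.1 hZ.1) _ (β := harmIdx d 0)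
        (by simp [harmIdx]; ring), hs]
      simp [coefA_harmIdx]
    · have h1 : 1 ≤ m := Nat.one_le_iff_ne_zero.2 hm
      rw [ballInt_ballPoly hd (isHomogeneous_gradPoly hY.1 hZ.1) _ (β := harmIdx d m - 1)
        (by push_cast [harmIdx, Nat.cast_sub h1]; ring), hs,
        show -(μ + (harmIdx d m - 1) + 2) = -(μ + harmIdx d m + 2) + 1 by ring,
        Real.rpow_add_one two_ne_zero]
      ring
  have hβ : (d : ℝ) + (m + m : ℕ) = 2 * harmIdx d m + 2 := by push_cast [harmIdx]; ring
  have hg : Polynomial.C 8 * ((1 + Polynomial.X) *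
          (Polynomial.derivative p * Polynomial.derivative q)) +
        (Polynomial.C (4 * m : ℝ) * (Polynomial.derivative p * q) +
          Polynomial.C (4 * m : ℝ) * (p * Polynomial.derivative q)) = gradIntegrand m p q := by
    rw [gradIntegrand]; ring
  have hb := inv_ballConst hd hμ
  rw [inv_eq_iff_eq_inv] at hb
  have hpow : (2 : ℝ) ^ (-(μ + harmIdx d m + 2)) = (2 * 2 ^ (harmIdx d m + μ + 1))⁻¹ := by
    rw [Real.rpow_neg two_pos.le, show μ + harmIdx d m + 2 = harmIdx d m + μ + 1 + 1 by ring,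
      Real.rpow_add_one two_ne_zero, mul_comm]
  have hS : sphereInner d Y Z = ((surfaceMeasure d).real univ)⁻¹ * sphereInt (Y * Z) := by
    simp only [sphereInner, sphereInt, evalAt_mul]
  rw [ballInner_eq, ballPoly_mul_ballPoly, gradPoly_ballPoly p q hY.1 hZ.1, ballInt_add hd hμ,
    hgrad, hg, ballInt_ballPoly hd (IsHomogeneous.mul hY.1 hZ.1) _ hβ,
    ballInt_ballPoly hd (IsHomogeneous.mul hY.1 hZ.1) _ hβ, uniInner_eq hd hμ, hb, hpow, hS]
  simp only [mul_inv, inv_inv, div_eq_mul_inv]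
  ring

lemma surfaceMeasure_real_univ_pos (hd : 1 ≤ d) : 0 < (surfaceMeasure d).real univ := by
  have : Nontrivial (EuclideanSpace ℝ (Fin d)) :=
    Module.nontrivial_of_finrank_pos (R := ℝ) (by simp; omega)
  have : IsFiniteMeasure (surfaceMeasure d) := by unfold surfaceMeasure; infer_instance
  have h : surfaceMeasure d ≠ 0 := Measure.toSphere_ne_zero _
  have : NeZero (surfaceMeasure d) := ⟨h⟩
  exact measureReal_univ_pos

lemma ballConst_pos (hd : 1 ≤ d) {μ : ℝ} (hμ : -1 < μ) : 0 < ballConst d μ := by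
  have hd' : (0 : ℝ) < d := by exact_mod_cast hd
  rw [← inv_pos, inv_ballConst hd hμ]
  have h1 := surfaceMeasure_real_univ_pos hd
  have h2 := Real.Gamma_pos_of_pos (half_pos hd')
  have h3 := Real.Gamma_pos_of_pos (by linarith : 0 < μ + 1)
  have h4 := Real.Gamma_pos_of_pos (by linarith : 0 < μ + 1 + (d : ℝ) / 2)
  positivity

lemma ballWeight_nonneg {μ : ℝ} {x : EuclideanSpace ℝ (Fin d)} (hx : x ∈ Metric.closedBall 0 1) :
    0 ≤ ballWeight d μ x := by
  rw [mem_closedBall_zero_iff] at hx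
  exact Real.rpow_nonneg (by nlinarith [norm_nonneg x]) _

lemma exists_mem_ball_evalAt_ne_zero {P : MvPolynomial (Fin d) ℝ} (hP : P ≠ 0) :
    ∃ x ∈ Metric.ball (0 : EuclideanSpace ℝ (Fin d)) 1, evalAt P x ≠ 0 := by
  by_contra! h
  -- The cube with sides (0, 1/(d+1)) lies in the ball since d/(d+1)² < 1, and a polynomial
  -- vanishing on a product of infinite sets is zero.
  refine hP (funext_set (fun _ => Ioo (0 : ℝ) (1 / (d + 1))) (fun _ => Ioo_infinite (by positivity))
    fun x hx => ?_)
  rw [map_zero]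
  refine h (WithLp.toLp 2 x) ?_
  rw [mem_ball_zero_iff, ← sq_lt_one_iff₀ (norm_nonneg _), EuclideanSpace.real_norm_sq_eq]
  have hx' : ∀ i, x i ^ 2 ≤ (1 / (d + 1 : ℝ)) ^ 2 := fun i =>
    pow_le_pow_left₀ (hx i trivial).1.le (hx i trivial).2.le 2
  refine (Finset.sum_le_sum fun i _ => hx' i).trans_lt ?_
  simp only [Finset.sum_const, Finset.card_univ, Fintype.card_fin, nsmul_eq_mul, one_div, inv_pow]
  rw [← div_eq_mul_inv, div_lt_one (by positivity)]
  nlinarith [Nat.cast_nonneg (α := ℝ) d]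

lemma ballInt_mul_self_pos (hd : 1 ≤ d) {μ : ℝ} (hμ : -1 < μ) {P : MvPolynomial (Fin d) ℝ}
    (hP : P ≠ 0) : 0 < ballInt μ (P * P) := by
  rw [ballInt, setIntegral_pos_iff_support_of_nonneg_ae]
  · obtain ⟨x, hx, hPx⟩ := exists_mem_ball_evalAt_ne_zero hP
    have hopen : IsOpen ({y | evalAt P y ≠ 0} ∩ Metric.ball 0 1) :=
      (isOpen_ne_fun (continuous_evalAt P) continuous_const).inter Metric.isOpen_ball
    refine (hopen.measure_pos volume ⟨x, hPx, hx⟩).trans_le (measure_mono ?_)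
    rintro y ⟨hy1, hy2⟩
    refine ⟨mul_ne_zero ?_ ?_, Metric.ball_subset_closedBall hy2⟩
    · rw [evalAt_mul]
      exact mul_self_ne_zero.2 hy1
    · rw [mem_ball_zero_iff] at hy2
      exact (Real.rpow_pos_of_pos (by nlinarith [norm_nonneg y]) _).ne'
  · filter_upwards [ae_restrict_mem Metric.isClosed_closedBall.measurableSet] with x hx
    rw [evalAt_mul]
    exact mul_nonneg (mul_self_nonneg _) (ballWeight_nonneg hx)
  · exact integrableOn_evalAt_mul_ballWeight hd hμ _

lemma ballInner_self_pos (hd : 1 ≤ d) {lam μ : ℝ} (hlam : 0 < lam) (hμ : -1 < μ)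
    {P : MvPolynomial (Fin d) ℝ} (hP : P ≠ 0) : 0 < ballInner d μ lam P P := by
  rw [ballInner_eq]
  refine mul_pos (ballConst_pos hd hμ) (add_pos_of_pos_of_nonneg (ballInt_mul_self_pos hd hμ hP)
    (mul_nonneg hlam.le ?_))
  refine setIntegral_nonneg Metric.isClosed_closedBall.measurableSet fun x hx => ?_
  rw [← gradDot_eq]
  exact mul_nonneg (Finset.sum_nonneg fun i _ => mul_self_nonneg _) (ballWeight_nonneg hx)

end BallSobolev
end

/-! ### Degrees and the splitting off of lower-degree polynomials. -/

noncomputable section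
namespace BallSobolev
open MvPolynomial Set

variable {d : ℕ}

lemma totalDegree_ballPoly_le {k : ℕ} (q : Polynomial ℝ) {Y : MvPolynomial (Fin d) ℝ}
    (hY : Y.IsHomogeneous k) : (ballPoly q Y).totalDegree ≤ 2 * q.natDegree + k := by
  refine (totalDegree_mul _ _).trans (add_le_add ?_ hY.totalDegree_le)
  have hs : (2 * normSq d - 1).totalDegree ≤ 2 := by
    refine (totalDegree_sub _ _).trans (max_le ?_ (by simp))
    rw [show (2 : MvPolynomial (Fin d) ℝ) = C 2 from (map_ofNat C 2).symm, ← smul_eq_C_mul]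
    exact (totalDegree_smul_le _ _).trans isHomogeneous_normSq.totalDegree_le
  change (Polynomial.aeval (2 * normSq d - 1) q).totalDegree ≤ _
  rw [Polynomial.aeval_eq_sum_range]
  refine totalDegree_finsetSum_le fun i hi => ?_
  refine (totalDegree_smul_le _ _).trans ((totalDegree_pow _ _).trans ?_)
  rw [mul_comm]
  exact Nat.mul_le_mul hs (Nat.lt_succ_iff.1 (Finset.mem_range.1 hi))

/-- Polynomials of total degree less than `n`, described by their generators `q(2‖x‖²-1) Y(x)`. -/
def lowSpace (d n : ℕ) : Submodule ℝ (MvPolynomial (Fin d) ℝ) :=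
  Submodule.span ℝ {F | ∃ k, ∃ Y ∈ harmonicSpace d k, ∃ q : Polynomial ℝ,
    2 * q.natDegree + k < n ∧ F = ballPoly q Y}

lemma normSq_pow_mul_eq_ballPoly (i : ℕ) (Y : MvPolynomial (Fin d) ℝ) :
    normSq d ^ i * Y = ballPoly ((Polynomial.C (1 / 2) * (Polynomial.X + 1)) ^ i) Y := by
  have h : Polynomial.aeval (2 * normSq d - 1) (Polynomial.C (1 / 2 : ℝ) * (Polynomial.X + 1)) =
      normSq d := by
    rw [map_mul, Polynomial.aeval_C, map_add, Polynomial.aeval_X, map_one, sub_add_cancel,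
      ← mul_assoc, algebraMap_eq, show (2 : MvPolynomial (Fin d) ℝ) = C 2 from
      (map_ofNat C 2).symm, ← C_mul]
    norm_num
  change _ = Polynomial.aeval (2 * normSq d - 1) _ * Y
  rw [map_pow, h]

lemma mem_lowSpace_of_totalDegree_lt (hd : 1 ≤ d) {n : ℕ} {Q : MvPolynomial (Fin d) ℝ}
    (hQ : Q.totalDegree < n) : Q ∈ lowSpace d n := by
  rw [← sum_homogeneousComponent Q]
  refine Submodule.sum_mem _ fun l hl => ?_
  refine Submodule.span_mono ?_ (mem_span_normSq_pow_mul_harmonic hd l _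
    (homogeneousComponent_isHomogeneous l Q))
  rintro _ ⟨i, k, hik, Y, hY, rfl⟩
  refine ⟨k, Y, hY, _, ?_, normSq_pow_mul_eq_ballPoly i Y⟩
  have hdeg : ((Polynomial.C (1 / 2 : ℝ) * (Polynomial.X + 1)) ^ i).natDegree ≤ i := by
    refine Polynomial.natDegree_pow_le.trans ?_
    have : (Polynomial.C (1 / 2 : ℝ) * (Polynomial.X + 1)).natDegree ≤ 1 := by compute_degree
    nlinarith
  have := Finset.mem_range.1 hl
  omega

lemma orthSpace_eq (hd : 1 ≤ d) {μ : ℝ} (hμ : -1 < μ) (lam : ℝ) (n : ℕ) :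
    orthSpace d μ lam n = ((restrictTotalDegree (Fin d) ℝ n ⊓
      (ballForm hd hμ lam).orthogonal (lowSpace d n) : Submodule ℝ (MvPolynomial (Fin d) ℝ)) :
        Set (MvPolynomial (Fin d) ℝ)) := by
  ext P
  simp only [orthSpace, mem_ofPred_eq, Submodule.coe_inf, mem_inter_iff, SetLike.mem_coe,
    mem_restrictTotalDegree, LinearMap.BilinForm.mem_orthogonal_iff]
  refine and_congr_right fun _ => ⟨fun h Q hQ => ?_, fun h Q hQ => ?_⟩
  · have hle : lowSpace d n ≤ LinearMap.ker (ballForm hd hμ lam P) := by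
      refine Submodule.span_le.2 ?_
      rintro _ ⟨k, Y, hY, q, hq, rfl⟩
      exact h _ ((totalDegree_ballPoly_le q hY.1).trans_lt hq)
    have := hle hQ
    rw [LinearMap.mem_ker, ballForm_apply, ballInner_comm] at this
    exact this
  · rw [ballInner_comm]
    exact h Q (mem_lowSpace_of_totalDegree_lt hd hQ)

/-- Only generators with 2 deg p + k = n matter. Subtracting the multiple of q_j with the same
leading term lowers the degree of p, and the harmonic factor is expanded in the basis Y_j. -/
lemma lowSpace_succ_le {n : ℕ} {q : Fin (n / 2 + 1) → Polynomial ℝ}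
    (hq : ∀ j, (q j).natDegree = j) (hq0 : ∀ j, q j ≠ 0)
    (Y : ∀ j : Fin (n / 2 + 1),
      Module.Basis (Fin (harmonicDim d (n - 2 * j))) ℝ (harmonicSpace d (n - 2 * j)))
    {R : (Σ j : Fin (n / 2 + 1), Fin (harmonicDim d (n - 2 * j))) → MvPolynomial (Fin d) ℝ}
    (hR : ∀ j ν, R ⟨j, ν⟩ = ballPoly (q j) (Y j ν)) :
    lowSpace d (n + 1) ≤ Submodule.span ℝ (range R) ⊔ lowSpace d n := by
  refine Submodule.span_le.2 ?_
  rintro _ ⟨k, Z, hZ, p, hp, rfl⟩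
  rcases (Nat.lt_succ_iff.1 hp).lt_or_eq with h | h
  · exact Submodule.mem_sup_right (Submodule.subset_span ⟨k, Z, hZ, p, h, rfl⟩)
  obtain ⟨j, hj⟩ : ∃ j : Fin (n / 2 + 1), (j : ℕ) = p.natDegree :=
    ⟨⟨p.natDegree, by omega⟩, rfl⟩
  obtain rfl : k = n - 2 * j := by omega
  -- The zero polynomial has `natDegree` 0, so it reaches this case when k = n.
  rcases eq_or_ne p 0 with rfl | hp0
  · simp [ballPoly]
  have hl : (q j).leadingCoeff ≠ 0 := Polynomial.leadingCoeff_ne_zero.2 (hq0 j)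
  set c : ℝ := p.leadingCoeff / (q j).leadingCoeff with hc
  have hc0 : c ≠ 0 := div_ne_zero (Polynomial.leadingCoeff_ne_zero.2 hp0) hl
  have hdeg : (p - Polynomial.C c * q j).degree < p.degree := by
    refine Polynomial.degree_sub_lt_left ?_ hp0 ?_
    · rw [Polynomial.degree_C_mul hc0, Polynomial.degree_eq_natDegree hp0,
        Polynomial.degree_eq_natDegree (hq0 j), hq, hj]
    · rw [Polynomial.leadingCoeff_mul, Polynomial.leadingCoeff_C, hc, div_mul_cancel₀ _ hl]
  have hsplit : ballPoly p Z = c • ballPoly (q j) Z + ballPoly (p - Polynomial.C c * q j) Z := by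
    simp only [ballPoly, map_sub, map_mul, Polynomial.aeval_C, algebraMap_eq, smul_eq_C_mul]
    ring
  rw [hsplit]
  refine Submodule.add_mem_sup (Submodule.smul_mem _ _ ?_) ?_
  · have hZ' : Z = ∑ ν, (Y j).repr ⟨Z, hZ⟩ ν • (Y j ν : MvPolynomial (Fin d) ℝ) := by
      have := congrArg (harmonicSpace d (n - 2 * j)).subtype ((Y j).sum_repr ⟨Z, hZ⟩)
      simp only [map_sum, map_smul, Submodule.subtype_apply] at this
      exact this.symm
    have : ballPoly (q j) Z = ∑ ν, (Y j).repr ⟨Z, hZ⟩ ν • R ⟨j, ν⟩ := by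
      conv_lhs => rw [hZ']
      simp only [hR, ballPoly, Finset.mul_sum, mul_smul_comm]
    rw [this]
    exact Submodule.sum_mem _ fun ν _ =>
      Submodule.smul_mem _ _ (Submodule.subset_span (mem_range_self _))
  · rcases eq_or_ne (p - Polynomial.C c * q j) 0 with h0 | h0
    · simp [h0, ballPoly]
    · refine Submodule.subset_span ⟨_, Z, hZ, _, ?_, rfl⟩
      have := Polynomial.natDegree_lt_natDegree h0 hdeg
      omega

lemma betaIdx_eq_harmIdx (d n : ℕ) (j : Fin (n / 2 + 1)) :
    betaIdx d n j = harmIdx d (n - 2 * j) := by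
  have hj : 2 * (j : ℕ) ≤ n := by have := j.2; omega
  rw [betaIdx, harmIdx]
  push_cast [Nat.cast_sub hj]
  ring

end BallSobolev
end

/-! ### The orthogonal basis and its norms. -/

theorem theorem5p2 (d : ℕ) (hd : 1 ≤ d) (lam μ : ℝ) (hlam : 0 < lam) (hμ : -1 < μ) (n : ℕ) :
    -- the univariate polynomials `q_j^{(μ, β_j)}` exist and are unique
    (∀ j : Fin (n / 2 + 1), ∃! p : Polynomial ℝ,
      IsSobolevOP d lam μ (betaIdx d n j) j p) ∧
    ∀ (q : Fin (n / 2 + 1) → Polynomial ℝ)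
      (_ : ∀ j : Fin (n / 2 + 1), IsSobolevOP d lam μ (betaIdx d n j) j (q j))
      (Y : ∀ j : Fin (n / 2 + 1),
        Module.Basis (Fin (harmonicDim d (n - 2 * j))) ℝ (harmonicSpace d (n - 2 * j)))
      (_ : ∀ j, IsOrthonormalHarmonic (Y j))
      (R : (Σ j : Fin (n / 2 + 1), Fin (harmonicDim d (n - 2 * j))) → MvPolynomial (Fin d) ℝ)
      (_ : ∀ j ν, R ⟨j, ν⟩ = ballPoly (q j) (Y j ν)),
      -- the `R_{j,ν}^n` form a mutually orthogonal basis of the orthogonal polynomials of degree `n`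
      LinearIndependent ℝ R ∧
      (Submodule.span ℝ (Set.range R) : Set (MvPolynomial (Fin d) ℝ)) = orthSpace d μ lam n ∧
      (∀ s t, s ≠ t → ballInner d μ lam (R s) (R t) = 0) ∧
      -- the norms
      ∀ j ν, ballInner d μ lam (R ⟨j, ν⟩) (R ⟨j, ν⟩) =
        Real.Gamma (μ + 1 + (d : ℝ) / 2) /
          (Real.Gamma (μ + 1) * Real.Gamma ((d : ℝ) / 2) * 2 ^ (betaIdx d n j + μ + 1)) *
          uniInner d lam μ (betaIdx d n j) (q j) (q j) := by
  refine ⟨fun j => ?_, fun q hq Y hY R hR => ?_⟩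
  · rw [betaIdx_eq_harmIdx]
    exact existsUnique_isSobolevOP hd hlam hμ j _
  simp only [betaIdx_eq_harmIdx] at hq ⊢
  have hq0 : ∀ j, q j ≠ 0 := fun j h => by
    have := (hq j).leadingCoeff_eq
    rw [h, Polynomial.leadingCoeff_zero] at this
    exact jacobiLead_ne_zero hd hμ j _ this.symm
  have hnorm : ∀ j ν, ballInner d μ lam (R ⟨j, ν⟩) (R ⟨j, ν⟩) =
        Real.Gamma (μ + 1 + (d : ℝ) / 2) /
          (Real.Gamma (μ + 1) * Real.Gamma ((d : ℝ) / 2) *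
            2 ^ (harmIdx d (n - 2 * j) + μ + 1)) *
          uniInner d lam μ (harmIdx d (n - 2 * j)) (q j) (q j) := fun j ν => by
    rw [hR, ballInner_ballPoly hd hμ lam _ _ (Y j ν).2 (Y j ν).2, hY j ν ν, if_pos rfl, mul_one]
  have hort : ∀ s t, s ≠ t → ballInner d μ lam (R s) (R t) = 0 := by
    rintro ⟨j, ν⟩ ⟨i, η⟩ hne
    rw [hR, hR]
    by_cases hji : j = i
    · subst hji
      have hνη : ν ≠ η := fun h => hne (by rw [h])
      rw [ballInner_ballPoly hd hμ lam _ _ (Y j ν).2 (Y j η).2, hY j ν η, if_neg hνη, mul_zero]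
    · refine ballInner_ballPoly_of_ne hd ?_ hμ lam _ _ (Y j ν).2 (Y i η).2
      have h1 := j.2
      have h2 := i.2
      have h3 : (j : ℕ) ≠ i := fun h => hji (Fin.ext h)
      omega
  have hR0 : ∀ s, R s ≠ 0 := fun ⟨j, ν⟩ h => by
    have h1 := hnorm j ν
    have h2 : ballInner d μ lam (R ⟨j, ν⟩) (R ⟨j, ν⟩) = 0 := by
      rw [← ballForm_apply hd hμ, h, map_zero]
    have h3 := uniInner_self_pos hd hlam hμ (n - 2 * j) (hq0 j)
    have hd' : (0 : ℝ) < d := by exact_mod_cast hd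
    have h4 := Real.Gamma_pos_of_pos (half_pos hd')
    have h5 := Real.Gamma_pos_of_pos (by linarith : 0 < μ + 1)
    have h6 := Real.Gamma_pos_of_pos (by linarith : 0 < μ + 1 + (d : ℝ) / 2)
    rw [h2] at h1
    exact absurd h1 (by positivity)
  refine ⟨?_, ?_, hort, hnorm⟩
  · refine LinearMap.BilinForm.linearIndependent_of_iIsOrtho (B := ballForm hd hμ lam)
      (fun s t hst => hort s t hst) fun s hs => ?_
    exact (ballInner_self_pos hd hlam hμ (hR0 s)).ne' hs
  have hmem : Submodule.span ℝ (Set.range R) ≤ MvPolynomial.restrictTotalDegree (Fin d) ℝ n ⊓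
      (ballForm hd hμ lam).orthogonal (lowSpace d n) := by
    refine Submodule.span_le.2 ?_
    rintro _ ⟨⟨j, ν⟩, rfl⟩
    have hj := j.2
    rw [hR]
    refine ⟨?_, ?_⟩
    · refine (MvPolynomial.mem_restrictTotalDegree _ _ _).2
        ((totalDegree_ballPoly_le _ (Y j ν).2.1).trans ?_)
      rw [(hq j).natDegree_eq]
      omega
    · have hle : lowSpace d n ≤
          LinearMap.ker (ballForm hd hμ lam (ballPoly (q j) (Y j ν))) := by
        refine Submodule.span_le.2 ?_
        rintro _ ⟨k, Z, hZ, p, hp, rfl⟩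
        change ballInner d μ lam _ _ = 0
        by_cases hk : k = n - 2 * j
        · subst hk
          -- For k = n - 2j the bound 2 deg p + k < n says deg p < j, which is where the
          -- orthogonality of q_j enters.
          rw [ballInner_ballPoly hd hμ lam _ _ (Y j ν).2 hZ, (hq j).orthogonal p, mul_zero, zero_mul]
          refine Polynomial.degree_le_natDegree.trans_lt ?_
          exact_mod_cast (by omega : p.natDegree < (j : ℕ))
        · exact ballInner_ballPoly_of_ne hd (Ne.symm hk) hμ lam _ _ (Y j ν).2 hZ
      refine LinearMap.BilinForm.mem_orthogonal_iff.2 fun Q hQ => ?_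
      have := hle hQ
      rw [LinearMap.mem_ker, ballForm_apply, ballInner_comm] at this
      exact this
  rw [orthSpace_eq hd hμ]
  refine Set.Subset.antisymm hmem fun P hP => ?_
  have hP1 : P.totalDegree ≤ n := (MvPolynomial.mem_restrictTotalDegree _ _ _).1 hP.1
  obtain ⟨r, hr, l, hl, rfl⟩ := Submodule.mem_sup.1
    (lowSpace_succ_le (fun j => (hq j).natDegree_eq) hq0 Y hR
      (mem_lowSpace_of_totalDegree_lt hd (Nat.lt_succ_iff.2 hP1)))
  -- Since r is already orthogonal to the lower space, so is l, which also lies in it.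
  have hl2 := (Submodule.add_mem_iff_right _ (hmem hr)).1 hP
  have hl0 : l = 0 := by
    by_contra hne
    exact (ballInner_self_pos hd hlam hμ hne).ne'
      (LinearMap.BilinForm.mem_orthogonal_iff.1 hl2.2 l hl)
  rw [hl0, add_zero]
  exact hr
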